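/- Let $n\ge 1$. A cube $Q\subset\mathbb R^n$ is a (non-degenerate) cube with sides parallel to the axes, and $|Q|$ is its Lebesgue measure. A Young function is a continuous, convex, strictly increasing $\Phi:[0,\infty)\to[0,\infty)$ with $\Phi(0)=0$ and $\Phi(t)/t\to\infty$ as $t\to\infty$; an associate function of $\Phi$ is a continuous, convex, nondecreasing function $\bar\Phi$ on $[0,\infty)$ with $\bar\Phi(0)=0$ and $t\le\Phi^{-1}(t)\,\bar\Phi^{-1}(t)\le 2t$ for all $t>0$, where $\Phi^{-1}(t)=\sup\{s\ge 0:\Phi(s)\le t\}$, and likewise for $\bar\Phi^{-1}$. For $1<\rho<\infty$ we write $\bar\Phi\in B_\rho$ if $\int_c^\infty \bar\Phi(t)\,t^{-\rho-1}\,dt<\infty$ for some $c>0$. For measurable $h:\mathbb R^n\to[0,\infty]$ put $$\|h\|_{\Phi,Q}=\inf\Big\{\lambda>0:\ \frac{1}{|Q|}\int_Q\Phi\big(h(x)/\lambda\big)\,dx\le 1\Big\},\qquad \Phi(\infty)=\infty,\ \inf\emptyset=\infty .$$ A weight is a measurable function $\mathbb R^n\to[0,\infty]$; products follow the convention $0\cdot\infty=0$,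 and $0^{-a}=\infty$, $\infty^{-a}=0$ for $a>0$. For $w$ a weight, $L^p(w)$ is the $L^p$ space of the measure $w\,dx$. For measurable $f,g:\mathbb R^n\to\mathbb C$ define $$\mathcal M^{r,s}_\alpha(f,g)(x)=\sup_{Q\ni x}|Q|^{\frac\alpha n}\Big(\frac{1}{|Q|}\int_Q|f|^r\Big)^{\frac1r}\Big(\frac{1}{|Q|}\int_Q|g|^s\Big)^{\frac1s}.$$ **Theorem.** Suppose $0\le\alpha<n$, $p_1>r>1$, $p_2>s>1$ and $1<p=\frac{p_1p_2}{p_1+p_2}\le q<\infty$. Let $\psi,\phi_1,\phi_2$ be Young functions with associate functions $\bar\psi,\bar\phi_1,\bar\phi_2$ such that $\bar\psi\in B_{q'}$ (where $q'=\frac q{q-1}$), $\bar\phi_1\in B_{p_1/r}$ and $\bar\phi_2\in B_{p_2/s}$. If the weights $(u,v_1,v_2)$ satisfy $$\sup_Q |Q|^{\frac{\alpha}{n}+\frac{1}{q}-\frac{1}{p}}\,\bigl\|u^{\frac1q}\bigr\|_{\psi,Q}\,\bigl\|v_1^{-\frac{r}{p_1}}\bigr\|_{\phi_1,Q}^{\frac1r}\,\bigl\|v_2^{-\frac{s}{p_2}}\bigr\|_{\phi_2,Q}^{\frac1s}<\infty,$$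 then there is a finite constant $C$ such that $$\|\mathcal M^{r,s}_\alpha(f,g)\|_{L^q(u)}\le C\,\|f\|_{L^{p_1}(v_1)}\,\|g\|_{L^{p_2}(v_2)}$$ for all $f\in L^{p_1}(v_1)$ and $g\in L^{p_2}(v_2)$. -/

import Mathlib

open MeasureTheory Set Filter Topology
open scoped ENNReal

noncomputable section

namespace BilinearBump

/-- The (half-open) cube in `ℝⁿ` with sides parallel to the axes, lower corner `a` and side
length `l`. -/
def cube {n : ℕ} (a : Fin n → ℝ) (l : ℝ) : Set (Fin n → ℝ) :=
  Set.univ.pi fun i => Set.Ico (a i) (a i + l)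

/-- A Young function. Only the values on `[0, ∞)` matter. -/
structure IsYoung (Φ : ℝ → ℝ) : Prop where
  continuousOn : ContinuousOn Φ (Set.Ici 0)
  convexOn : ConvexOn ℝ (Set.Ici 0) Φ
  strictMonoOn : StrictMonoOn Φ (Set.Ici 0)
  map_zero : Φ 0 = 0
  superlinear : Tendsto (fun t => Φ t / t) atTop atTop

/-- The inverse of a nondecreasing function on `[0, ∞)`, in the form
`Φ⁻¹(t) = sup {s ≥ 0 | Φ(s) ≤ t}`. For a Young function this is the usual inverse. -/
def inv (Φ : ℝ → ℝ) (t : ℝ) : ℝ := sSup {s : ℝ | 0 ≤ s ∧ Φ s ≤ t}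

/-- `Ψ` is an associate function of `Φ`: `t ≤ Φ⁻¹(t) Ψ⁻¹(t) ≤ 2 t` for `t > 0`.
`Ψ` is allowed to be constant near `0`, so that the complementary function
`sup_s (s t - Φ s)` of every Young function `Φ` is admitted, also when `Φ'(0+) > 0`;
every Young function `Ψ` with the displayed property is admitted. -/
structure IsAssociate (Φ Ψ : ℝ → ℝ) : Prop where
  continuousOn : ContinuousOn Ψ (Set.Ici 0)
  convexOn : ConvexOn ℝ (Set.Ici 0) Ψ
  monotoneOn : MonotoneOn Ψ (Set.Ici 0)
  map_zero : Ψ 0 = 0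
  le_inv_mul_inv : ∀ t : ℝ, 0 < t → t ≤ inv Φ t * inv Ψ t
  inv_mul_inv_le : ∀ t : ℝ, 0 < t → inv Φ t * inv Ψ t ≤ 2 * t

/-- The integrability condition `B_p`: `∫_c^∞ Φ(t) / t^(p+1) dt < ∞` for some `c > 0`. -/
def MemB (p : ℝ) (Φ : ℝ → ℝ) : Prop :=
  ∃ c : ℝ, 0 < c ∧ IntegrableOn (fun t : ℝ => Φ t / t ^ (p + 1)) (Set.Ioi c) volume

/-- Extension of `Φ : [0, ∞) → [0, ∞)` to `[0, ∞]` by `Φ(∞) = ∞`. -/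
def ext (Φ : ℝ → ℝ) (t : ℝ≥0∞) : ℝ≥0∞ :=
  if t = ∞ then ∞ else ENNReal.ofReal (Φ t.toReal)

/-- The Orlicz average `‖h‖_{Φ,Q} = inf {c > 0 | ⨍_Q Φ(h / c) ≤ 1}` of `h : ℝⁿ → [0, ∞]`,
with value `∞` if there is no such `c`. -/
def orliczAvg {n : ℕ} (Φ : ℝ → ℝ) (Q : Set (Fin n → ℝ)) (h : (Fin n → ℝ) → ℝ≥0∞) : ℝ≥0∞ :=
  ⨅ (c : ℝ) (_ : 0 < c) (_ : ⨍⁻ x in Q, ext Φ (h x / ENNReal.ofReal c) ∂volume ≤ 1),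
    ENNReal.ofReal c

/-- The bilinear fractional maximal function
`sup_{Q ∋ x} |Q|^(α/n) (⨍_Q |f|^r)^(1/r) (⨍_Q |g|^s)^(1/s)`. -/
def maximalFn {n : ℕ} (α r s : ℝ) (f g : (Fin n → ℝ) → ℂ) (x : Fin n → ℝ) : ℝ≥0∞ :=
  ⨆ (a : Fin n → ℝ) (l : ℝ) (_ : 0 < l) (_ : x ∈ cube a l),
    volume (cube a l) ^ (α / n)
      * (⨍⁻ y in cube a l, ‖f y‖ₑ ^ r ∂volume) ^ (1 / r)
      * (⨍⁻ y in cube a l, ‖g y‖ₑ ^ s ∂volume) ^ (1 / s)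

/-- The supremum over all cubes in the bump condition on the weights `(u, v₁, v₂)`. -/
def bumpConst {n : ℕ} (α p q p₁ p₂ r s : ℝ) (ψ φ₁ φ₂ : ℝ → ℝ)
    (u v₁ v₂ : (Fin n → ℝ) → ℝ≥0∞) : ℝ≥0∞ :=
  ⨆ (a : Fin n → ℝ) (l : ℝ) (_ : 0 < l),
    volume (cube a l) ^ (α / n + 1 / q - 1 / p)
      * orliczAvg ψ (cube a l) (fun x => u x ^ (1 / q))
      * orliczAvg φ₁ (cube a l) (fun x => v₁ x ^ (-(r / p₁))) ^ (1 / r)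
      * orliczAvg φ₂ (cube a l) (fun x => v₂ x ^ (-(s / p₂))) ^ (1 / s)

end BilinearBump

end

noncomputable section

namespace BilinearBump

/-! Every cube lies in a comparable cube from one of `2 ^ n` translated dyadic grids. It therefore
suffices to bound the maximal function over finite families of dyadic cubes, uniformly in the family
and the translation; monotone convergence and Fatou's lemma do the rest. In a finite family maximal
cubes always exist, so no decay of the averages over large cubes is needed.

Let `B_Q` be the product inside the supremum and `t = rs/(r+s)`, so that `t/r + t/s = 1`. Then
`B_Q^t |Q| = |Q|^(αt/n) (∫_Q |f|^r)^(t/r) (∫_Q |g|^s)^(t/s)`, and Hölder for sums gives the packing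
bound `∑ B_P^t |P| ≤ B_Q^t |Q|` for disjoint `P ⊆ Q` (`sum_bilinAvg_rpow_mul_volume_le`).
Consequently the maximal cubes at level `2 ^ (k + 2)` fill at most half of a maximal cube at level
`2 ^ k` whose coefficient `B_Q^t` is at most `2 ^ (k + 1)`. The remaining parts overlap boundedly
over all `k`.

The weights enter through a testing bound on single cubes (`bilinAvg_rpow_mul_withDensity_le`).
Orlicz–Hölder splits `|f|^r = (|f|^r v₁^(r/p₁)) v₁^(-r/p₁)`, and likewise for `g`; the `B_{q'}`
condition makes `ψ` dominate `t ↦ t^q`, so `u(Q) ≤ C |Q| ‖u^(1/q)‖_{ψ,Q}^q`. The bump condition then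
yields `B_Q^q u(Q) ≤ K (|Q| h_Q)^(q/p)`, where `h_Q = (X_Q^(1/r) Y_Q^(1/s))^p` and `X_Q`, `Y_Q` are
the averages of `|f|^r v₁^(r/p₁)` and `|g|^s v₂^(s/p₂)` in the associate functions.

Packing and testing together give a Carleson embedding (`lintegral_maxOn_rpow_le`), which uses `q/p
≥ 1`, with the integral of a pointwise majorant of the `h_Q` on the right. That majorant is a
product of powers of two Orlicz maximal functions. Hölder with `p/p₁ + p/p₂ = 1` separates them, and
the conditions `B_{p₁/r}` and `B_{p₂/s}` bound each one (`exists_lintegral_maxOn_orliczAvg_le`). -/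

lemma two_zpow_lt_two_zpow {i j : ℤ} (h : i < j) : (2 : ℝ≥0∞) ^ i < 2 ^ j := by
  rw [show (2 : ℝ≥0∞) = ((2 : NNReal) : ℝ≥0∞) by simp, ← ENNReal.coe_zpow (by simp),
    ← ENNReal.coe_zpow (by simp), ENNReal.coe_lt_coe]
  exact zpow_lt_zpow_right₀ (by norm_num) h

lemma rpow_sub_one_mul_self (x : ℝ≥0∞) {θ : ℝ} (hθ : 1 ≤ θ) : x ^ (θ - 1) * x = x ^ θ := by
  conv_lhs => rw [← ENNReal.rpow_one x, ← ENNReal.rpow_mul, one_mul]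
  rw [← ENNReal.rpow_add_of_nonneg _ _ (by linarith) (by simp), sub_add_cancel]

/-! ### Stopping sets in finite nested families. -/

section Laminar

variable {X : Type*}

/-- Any two members of the family that meet are nested. -/
def Laminar (𝒢 : Set (Set X)) : Prop :=
  ∀ P ∈ 𝒢, ∀ Q ∈ 𝒢, (P ∩ Q).Nonempty → P ⊆ Q ∨ Q ⊆ P

/-- The maximal function of a coefficient family `A` over the finite family `𝒢`. -/
def maxOn (𝒢 : Finset (Set X)) (A : Set X → ℝ≥0∞) (x : X) : ℝ≥0∞ :=
  𝒢.sup fun Q => Q.indicator (fun _ => A Q) x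

open scoped Classical in
/-- The maximal members of `𝒢` whose coefficient exceeds `c`. -/
def maxSets (𝒢 : Finset (Set X)) (A : Set X → ℝ≥0∞) (c : ℝ≥0∞) : Finset (Set X) :=
  𝒢.filter fun Q => Maximal (fun P => P ∈ 𝒢 ∧ c < A P) Q

variable {𝒢 : Finset (Set X)} {A : Set X → ℝ≥0∞} {c : ℝ≥0∞} {x : X}

lemma lt_maxOn : c < maxOn 𝒢 A x ↔ ∃ Q ∈ 𝒢, c < A Q ∧ x ∈ Q := by
  classical
  rw [maxOn, Finset.lt_sup_iff]
  refine exists_congr fun Q => and_congr_right fun _ => ?_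
  by_cases hx : x ∈ Q <;> simp [hx]

lemma le_maxOn {Q : Set X} (hQ : Q ∈ 𝒢) (hx : x ∈ Q) : A Q ≤ maxOn 𝒢 A x := by
  have h := Finset.le_sup (f := fun Q : Set X => Q.indicator (fun _ => A Q) x) hQ
  simpa [maxOn, hx] using h

lemma maxOn_le_iff : maxOn 𝒢 A x ≤ c ↔ ∀ Q ∈ 𝒢, x ∈ Q → A Q ≤ c := by
  rw [← not_lt, lt_maxOn]
  push Not
  exact ⟨fun h Q hQ hx => not_lt.1 fun h' => h Q hQ h' hx,
    fun h Q hQ h' hx => absurd (h Q hQ hx) (not_le.2 h')⟩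

lemma measurable_maxOn [MeasurableSpace X] (hm : ∀ Q ∈ 𝒢, MeasurableSet Q) :
    Measurable (maxOn 𝒢 A) := by
  have : maxOn 𝒢 A = fun x => ⨆ Q ∈ 𝒢, Q.indicator (fun _ => A Q) x := by
    ext x; rw [maxOn, Finset.sup_eq_iSup]
  rw [this]
  exact Measurable.biSup _ 𝒢.countable_toSet fun Q hQ => measurable_const.indicator (hm Q hQ)

lemma mem_maxSets {Q : Set X} :
    Q ∈ maxSets 𝒢 A c ↔ Q ∈ 𝒢 ∧ c < A Q ∧ ∀ P ∈ 𝒢, c < A P → Q ⊆ P → P = Q := by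
  classical
  rw [maxSets, Finset.mem_filter]
  constructor
  · rintro ⟨h, h'⟩
    exact ⟨h, h'.prop.2, fun P hP hc hQP => (h'.eq_of_le ⟨hP, hc⟩ hQP).symm⟩
  · rintro ⟨h, hc, h'⟩
    exact ⟨h, ⟨h, hc⟩, fun P hP hQP => (h' P hP.1 hP.2 hQP).le⟩

/-- Finiteness of the family supplies a maximal member above any admissible one. -/
lemma exists_maxSets_superset {Q : Set X} (hQ : Q ∈ 𝒢) (hc : c < A Q) :
    ∃ P ∈ maxSets 𝒢 A c, Q ⊆ P := by
  classical
  obtain ⟨P, hQP, hP⟩ := Finset.exists_le_maximal (𝒢.filter fun P => c < A P)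
    (Finset.mem_filter.2 ⟨hQ, hc⟩)
  refine ⟨P, ?_, hQP⟩
  rw [maxSets, Finset.mem_filter]
  simp only [Finset.mem_filter] at hP
  exact ⟨hP.prop.1, hP⟩

lemma pairwiseDisjoint_maxSets (hl : Laminar (𝒢 : Set (Set X))) :
    (maxSets 𝒢 A c : Set (Set X)).PairwiseDisjoint id := by
  intro P hP Q hQ hne
  rw [Finset.mem_coe, mem_maxSets] at hP hQ
  by_contra hd
  rw [Function.onFun, id, id, not_disjoint_iff_nonempty_inter] at hd
  rcases hl P hP.1 Q hQ.1 hd with h | h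
  · exact hne (hP.2.2 Q hQ.1 hQ.2.1 h).symm
  · exact hne (hQ.2.2 P hP.1 hP.2.1 h)

/-- With `pairwiseDisjoint_maxSets`, this splits a superlevel set into disjoint stopping sets when
the family is laminar. -/
lemma setOf_lt_maxOn : {x | c < maxOn 𝒢 A x} = ⋃ Q ∈ maxSets 𝒢 A c, Q := by
  ext x
  simp only [mem_ofPred_eq, lt_maxOn, mem_iUnion, exists_prop]
  constructor
  · rintro ⟨Q, hQ, hc, hx⟩
    obtain ⟨P, hP, hQP⟩ := exists_maxSets_superset hQ hc
    exact ⟨P, hP, hQP hx⟩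
  · rintro ⟨Q, hQ, hx⟩
    rw [mem_maxSets] at hQ
    exact ⟨Q, hQ.1, hQ.2.1, hx⟩

end Laminar

/-! ### A Carleson embedding from packing and testing. -/

section Carleson

variable {X : Type*} [MeasurableSpace X] {μ ν : Measure X} {𝒢 : Finset (Set X)}
  {A h : Set X → ℝ≥0∞} {H : X → ℝ≥0∞}

/-- The packing condition forces the part of a member `Q` with coefficient about `2 ^ k` where the
maximal function exceeds `2 ^ (k + 2)` to have at most half of the measure. -/
lemma measure_le_two_mul_diff (hl : Laminar (𝒢 : Set (Set X)))
    (hm : ∀ Q ∈ 𝒢, MeasurableSet Q) (hμ : ∀ Q ∈ 𝒢, μ Q ≠ ∞)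
    (hpack : ∀ Q ∈ 𝒢, ∀ 𝒮 ⊆ 𝒢, (𝒮 : Set (Set X)).PairwiseDisjoint id →
      (∀ P ∈ 𝒮, P ⊆ Q) → ∑ P ∈ 𝒮, A P * μ P ≤ A Q * μ Q)
    {Q : Set X} {k : ℤ} (hQ : Q ∈ maxSets 𝒢 A (2 ^ k)) (hAQ : A Q ≤ 2 ^ (k + 1)) :
    μ Q ≤ 2 * μ (Q ∩ {x | maxOn 𝒢 A x ≤ 2 ^ (k + 2)}) := by
  classical
  have hQ' := mem_maxSets.1 hQ
  set 𝒮 := (maxSets 𝒢 A (2 ^ (k + 2))).filter fun P => P ⊆ Q with h𝒮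
  have h𝒮𝒢 : 𝒮 ⊆ 𝒢 := fun P hP =>
    (mem_maxSets.1 (Finset.mem_filter.1 hP).1).1
  have h2 : (2 : ℝ≥0∞) ^ (k + 2) = 2 * 2 ^ (k + 1) := by
    rw [show k + 2 = 1 + (k + 1) by ring, ENNReal.zpow_add (by simp) (by simp), zpow_one]
  have hpos : (2 : ℝ≥0∞) ^ (k + 1) ≠ 0 := (ENNReal.zpow_pos (by simp) (by simp) _).ne'
  have hfin : (2 : ℝ≥0∞) ^ (k + 1) ≠ ∞ := (ENNReal.zpow_lt_top (by simp) (by simp) _).ne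
  have hlt : (2 : ℝ≥0∞) ^ (k + 1) < 2 ^ (k + 2) := two_zpow_lt_two_zpow (by lia)
  -- A stopping set `P` of the higher level that meets `Q` cannot strictly contain it, since `Q` is
  -- already maximal at the lower level.
  have hcov : Q ∩ {x | 2 ^ (k + 2) < maxOn 𝒢 A x} ⊆ ⋃ P ∈ 𝒮, P := by
    rintro x ⟨hxQ, hx⟩
    rw [setOf_lt_maxOn] at hx
    simp only [mem_iUnion, exists_prop] at hx ⊢
    obtain ⟨P, hP, hxP⟩ := hx
    have hP' := mem_maxSets.1 hP
    refine ⟨P, Finset.mem_filter.2 ⟨hP, ?_⟩, hxP⟩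
    rcases hl P hP'.1 Q hQ'.1 ⟨x, hxP, hxQ⟩ with h | h
    · exact h
    · have : P = Q := hQ'.2.2 P hP'.1
        (lt_trans (two_zpow_lt_two_zpow (by lia)) hP'.2.1) h
      exact this.le
  -- Coefficients exceed `2 ^ (k + 2)` on the sets `P` and are at most `2 ^ (k + 1)` on `Q`; packing
  -- turns this ratio into the factor one half.
  have hsum : 2 ^ (k + 1) * (2 * ∑ P ∈ 𝒮, μ P) ≤ 2 ^ (k + 1) * μ Q := by
    calc 2 ^ (k + 1) * (2 * ∑ P ∈ 𝒮, μ P) = ∑ P ∈ 𝒮, 2 ^ (k + 2) * μ P := by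
          rw [← Finset.mul_sum, h2]; ring
      _ ≤ ∑ P ∈ 𝒮, A P * μ P := by
          refine Finset.sum_le_sum fun P hP => ?_
          gcongr
          exact (mem_maxSets.1 (Finset.mem_filter.1 hP).1).2.1.le
      _ ≤ A Q * μ Q := hpack Q hQ'.1 𝒮 h𝒮𝒢
          ((pairwiseDisjoint_maxSets hl).subset fun P hP => (Finset.mem_filter.1 hP).1)
          fun P hP => (Finset.mem_filter.1 hP).2
      _ ≤ 2 ^ (k + 1) * μ Q := by gcongr
  rw [ENNReal.mul_le_mul_iff_right hpos hfin] at hsum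
  have hsmall : 2 * μ (Q ∩ {x | 2 ^ (k + 2) < maxOn 𝒢 A x}) ≤ μ Q :=
    le_trans (by gcongr; exact (measure_mono hcov).trans (measure_biUnion_finset_le _ _)) hsum
  have hsplit : μ Q = μ (Q ∩ {x | maxOn 𝒢 A x ≤ 2 ^ (k + 2)})
      + μ (Q ∩ {x | 2 ^ (k + 2) < maxOn 𝒢 A x}) := by
    rw [← measure_inter_add_sdiff Q (measurableSet_le (measurable_maxOn hm) measurable_const)]
    congr 2
    ext x; simp
  have hfin' := ne_top_of_le_ne_top (hμ Q hQ'.1)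
    (measure_mono (μ := μ) (inter_subset_left (s := Q) (t := {x | 2 ^ (k + 2) < maxOn 𝒢 A x})))
  have : μ Q + μ (Q ∩ {x | 2 ^ (k + 2) < maxOn 𝒢 A x})
      + μ (Q ∩ {x | 2 ^ (k + 2) < maxOn 𝒢 A x}) ≤
      2 * μ (Q ∩ {x | maxOn 𝒢 A x ≤ 2 ^ (k + 2)}) + μ (Q ∩ {x | 2 ^ (k + 2) < maxOn 𝒢 A x})
      + μ (Q ∩ {x | 2 ^ (k + 2) < maxOn 𝒢 A x}) := by
    calc _ = μ Q + 2 * μ (Q ∩ {x | 2 ^ (k + 2) < maxOn 𝒢 A x}) := by ring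
      _ ≤ μ Q + μ Q := by gcongr
      _ = _ := by rw [hsplit]; ring
  exact (ENNReal.add_le_add_iff_right hfin').1 ((ENNReal.add_le_add_iff_right hfin').1 this)

/-- A Carleson type embedding: packing together with the testing bound `A Q ^ e ν Q ≤ K (μ Q h) ^ θ`
bounds the maximal function in `L ^ e (ν)`. -/
theorem lintegral_maxOn_rpow_le (hl : Laminar (𝒢 : Set (Set X)))
    (hm : ∀ Q ∈ 𝒢, MeasurableSet Q) (hμ : ∀ Q ∈ 𝒢, μ Q ≠ ∞)
    (hpack : ∀ Q ∈ 𝒢, ∀ 𝒮 ⊆ 𝒢, (𝒮 : Set (Set X)).PairwiseDisjoint id →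
      (∀ P ∈ 𝒮, P ⊆ Q) → ∑ P ∈ 𝒮, A P * μ P ≤ A Q * μ Q)
    {e θ : ℝ} (he : 0 < e) (hθ : 1 ≤ θ) {K : ℝ≥0∞} (hK : K ≠ ∞)
    (htest : ∀ Q ∈ 𝒢, A Q ^ e * ν Q ≤ K * (μ Q * h Q) ^ θ)
    (hH : ∀ Q ∈ 𝒢, ∀ x ∈ Q, h Q ≤ H x) (hHfin : ∫⁻ x, H x ∂μ ≠ ∞) :
    ∫⁻ x, maxOn 𝒢 A x ^ e ∂ν ≤ 2 ^ e * K * (4 * (∫⁻ x, H x ∂μ) ^ θ) := by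
  classical
  set I := ∫⁻ x, H x ∂μ with hI
  have hM := measurable_maxOn (A := A) hm
  set D : ℤ → Set X := fun k => {x | 2 ^ k < maxOn 𝒢 A x ∧ maxOn 𝒢 A x ≤ 2 ^ (k + 1)} with hD
  have hDm : ∀ k, MeasurableSet (D k) := fun k =>
    (measurableSet_lt measurable_const hM).inter (measurableSet_le hM measurable_const)
  have hDd : Pairwise (Function.onFun Disjoint D) := by
    have key : ∀ i j : ℤ, i < j → Disjoint (D i) (D j) := by
      intro i j hij
      refine disjoint_left.2 fun x hi hj => ?_
      have : (2 : ℝ≥0∞) ^ (i + 1) ≤ 2 ^ j := ENNReal.zpow_le_of_le (by norm_num) (by lia)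
      exact absurd (hi.2.trans this) (not_le.2 hj.1)
    intro i j hij
    rcases lt_or_gt_of_ne hij with h | h
    · exact key i j h
    · exact (key j i h).symm
  have hhQ : ∀ Q ∈ 𝒢, μ Q * h Q ≤ I := by
    intro Q hQ
    calc μ Q * h Q = ∫⁻ x in Q, h Q ∂μ := by rw [setLIntegral_const, mul_comm]
      _ ≤ ∫⁻ x in Q, H x ∂μ := setLIntegral_mono' (hm Q hQ) (hH Q hQ)
      _ ≤ I := setLIntegral_le_lintegral _ _
  -- the maximal function is finite almost everywhere
  have htop : ν {x | maxOn 𝒢 A x = ∞} = 0 := by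
    have hsub : {x | maxOn 𝒢 A x = ∞} ⊆ ⋃ Q ∈ 𝒢.filter (fun Q => A Q = ∞), Q := by
      intro x hx
      by_contra hcon
      simp only [Finset.mem_filter, mem_iUnion, exists_prop, not_exists, not_and, and_imp] at hcon
      have : maxOn 𝒢 A x < ∞ := by
        rw [maxOn, Finset.sup_lt_iff (by simp)]
        intro Q hQ
        by_cases hxQ : x ∈ Q
        · simpa [hxQ] using lt_top_iff_ne_top.2 fun hA => hcon Q hQ hA hxQ
        · simp [hxQ]
      exact this.ne hx
    refine measure_mono_null hsub ?_
    refine (measure_biUnion_null_iff (Finset.countable_toSet _)).2 fun Q hQ => ?_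
    obtain ⟨hQ, hA⟩ := Finset.mem_filter.1 (Finset.mem_coe.1 hQ)
    have h1 := htest Q hQ
    have h2 : K * (μ Q * h Q) ^ θ ≠ ∞ := ENNReal.mul_ne_top hK
      (ENNReal.rpow_ne_top_of_nonneg (by linarith) (ne_top_of_le_ne_top hHfin (hhQ Q hQ)))
    by_contra h0
    rw [hA, ENNReal.top_rpow_of_pos he, ENNReal.top_mul h0] at h1
    exact h2 (top_le_iff.1 h1)
  -- A stopping set with coefficient above `2 ^ (k + 1)` misses the layer `D k`, so it can be
  -- discarded. This upper bound replaces the usual comparison with the dyadic parent.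
  set T : ℤ → Finset (Set X) := fun k =>
    (maxSets 𝒢 A (2 ^ k)).filter fun Q => A Q ≤ 2 ^ (k + 1) with hT
  have hT' : ∀ k, ∀ Q ∈ T k, Q ∈ 𝒢 ∧ Q ∈ maxSets 𝒢 A (2 ^ k) ∧ 2 ^ k < A Q ∧ A Q ≤ 2 ^ (k + 1) := by
    intro k Q hQ
    obtain ⟨h1, h2⟩ := Finset.mem_filter.1 hQ
    have h3 := mem_maxSets.1 h1
    exact ⟨h3.1, h1, h3.2.1, h2⟩
  -- one layer, measured by `ν`
  have hlayer : ∀ k, ∫⁻ x in D k, maxOn 𝒢 A x ^ e ∂ν ≤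
      2 ^ e * K * (I ^ (θ - 1) * ∑ Q ∈ T k, μ Q * h Q) := by
    intro k
    have hcov : D k ⊆ ⋃ Q ∈ T k, Q := by
      rintro x ⟨hx1, hx2⟩
      have hx1' : x ∈ {x | 2 ^ k < maxOn 𝒢 A x} := hx1
      rw [setOf_lt_maxOn] at hx1'
      simp only [mem_iUnion, exists_prop] at hx1' ⊢
      obtain ⟨Q, hQ, hxQ⟩ := hx1'
      exact ⟨Q, Finset.mem_filter.2 ⟨hQ, (le_maxOn (mem_maxSets.1 hQ).1 hxQ).trans hx2⟩, hxQ⟩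
    calc ∫⁻ x in D k, maxOn 𝒢 A x ^ e ∂ν ≤ ∫⁻ x in D k, (2 ^ (k + 1)) ^ e ∂ν :=
          setLIntegral_mono' (hDm k) fun x hx => ENNReal.rpow_le_rpow hx.2 he.le
      _ = (2 ^ (k + 1)) ^ e * ν (D k) := setLIntegral_const _ _
      _ ≤ (2 ^ (k + 1)) ^ e * ∑ Q ∈ T k, ν Q := by
          gcongr
          exact (measure_mono hcov).trans (measure_biUnion_finset_le _ _)
      _ ≤ ∑ Q ∈ T k, 2 ^ e * K * (I ^ (θ - 1) * (μ Q * h Q)) := by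
          rw [Finset.mul_sum]
          refine Finset.sum_le_sum fun Q hQ => ?_
          obtain ⟨hQ𝒢, -, hQl, -⟩ := hT' k Q hQ
          calc ((2 : ℝ≥0∞) ^ (k + 1)) ^ e * ν Q ≤ (2 * A Q) ^ e * ν Q := by
                gcongr
                rw [add_comm, ENNReal.zpow_add (by simp) (by simp), zpow_one]
                gcongr
            _ = 2 ^ e * (A Q ^ e * ν Q) := by
                rw [ENNReal.mul_rpow_of_nonneg _ _ he.le, mul_assoc]
            _ ≤ 2 ^ e * (K * (μ Q * h Q) ^ θ) := by gcongr 2 ^ e * ?_; exact htest Q hQ𝒢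
            -- Since `θ ≥ 1`, all but one power of `μ Q * h Q` is absorbed by the total integral
            -- `I`, leaving a quantity that sums linearly.
            _ = 2 ^ e * K * ((μ Q * h Q) ^ (θ - 1) * (μ Q * h Q)) := by
                rw [rpow_sub_one_mul_self _ hθ, mul_assoc]
            _ ≤ _ := by
                gcongr
                exact hhQ Q hQ𝒢
      _ = _ := by simp_rw [Finset.mul_sum]
  -- Half of each stopping set lies where the maximal function is at most `2 ^ (k + 2)`, hence in `D
  -- k ∪ D (k + 1)`. Summed over `k`, each layer is used twice; with the factor 2 from halving this
  -- gives the constant 4.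
  have hlayer' : ∀ k, ∑ Q ∈ T k, μ Q * h Q ≤
      2 * (∫⁻ x in D k, H x ∂μ + ∫⁻ x in D (k + 1), H x ∂μ) := by
    intro k
    set E := {x | maxOn 𝒢 A x ≤ 2 ^ (k + 2)} with hE
    have hEm : MeasurableSet E := measurableSet_le hM measurable_const
    calc ∑ Q ∈ T k, μ Q * h Q ≤ ∑ Q ∈ T k, 2 * ∫⁻ x in Q ∩ E, H x ∂μ := by
          refine Finset.sum_le_sum fun Q hQ => ?_
          obtain ⟨hQ𝒢, hQm, -, hQu⟩ := hT' k Q hQ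
          calc μ Q * h Q ≤ 2 * μ (Q ∩ E) * h Q := by
                gcongr
                exact measure_le_two_mul_diff hl hm hμ hpack hQm hQu
            _ = 2 * ∫⁻ x in Q ∩ E, h Q ∂μ := by rw [setLIntegral_const]; ring
            _ ≤ _ := by
                gcongr 2 * ?_
                exact setLIntegral_mono' ((hm Q hQ𝒢).inter hEm) fun x hx => hH Q hQ𝒢 x hx.1
      _ = 2 * ∫⁻ x in ⋃ Q ∈ T k, Q ∩ E, H x ∂μ := by
          rw [← Finset.mul_sum, lintegral_biUnion_finset]
          · intro P hP Q hQ hne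
            exact (pairwiseDisjoint_maxSets hl (hT' k P hP).2.1 (hT' k Q hQ).2.1 hne).mono
              inter_subset_left inter_subset_left
          · exact fun Q hQ => (hm Q (hT' k Q hQ).1).inter hEm
      _ ≤ 2 * ∫⁻ x in D k ∪ D (k + 1), H x ∂μ := by
          gcongr 2 * ?_
          refine lintegral_mono_set ?_
          simp only [iUnion_subset_iff]
          rintro Q hQ x ⟨hxQ, hxE⟩
          obtain ⟨hQ𝒢, -, hQl, -⟩ := hT' k Q hQ
          rcases le_or_gt (maxOn 𝒢 A x) (2 ^ (k + 1)) with hle | hgt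
          · exact Or.inl ⟨hQl.trans_le (le_maxOn hQ𝒢 hxQ), hle⟩
          · refine Or.inr ⟨hgt, ?_⟩
            rw [add_assoc]; exact hxE
      _ ≤ _ := by
          gcongr 2 * ?_
          exact lintegral_union_le _ _ _
  have hDsum : ∑' k, ∫⁻ x in D k, H x ∂μ ≤ I := by
    rw [← lintegral_iUnion hDm hDd]
    exact setLIntegral_le_lintegral _ _
  have hDsum' : ∑' k, ∫⁻ x in D (k + 1), H x ∂μ ≤ I := by
    refine le_trans (le_of_eq ?_) hDsum
    exact (Equiv.addRight (1 : ℤ)).tsum_eq fun k => ∫⁻ x in D k, H x ∂μ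
  have hcover : ∀ᵐ x ∂ν, maxOn 𝒢 A x ^ e ≤ (⋃ k, D k).indicator (fun x => maxOn 𝒢 A x ^ e) x := by
    have : ∀ᵐ x ∂ν, maxOn 𝒢 A x ≠ ∞ := by
      rw [ae_iff]; simpa using htop
    filter_upwards [this] with x hx
    by_cases h0 : maxOn 𝒢 A x = 0
    · simp [h0, he]
    · obtain ⟨k, hk⟩ := ENNReal.exists_mem_Ioc_zpow h0 hx (y := 2) (by norm_num) (by simp)
      have hxD : x ∈ ⋃ k, D k := mem_iUnion.2 ⟨k, hk.1, hk.2⟩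
      rw [indicator_of_mem hxD]
  calc ∫⁻ x, maxOn 𝒢 A x ^ e ∂ν
      ≤ ∫⁻ x, (⋃ k, D k).indicator (fun x => maxOn 𝒢 A x ^ e) x ∂ν := lintegral_mono_ae hcover
    _ = ∫⁻ x in ⋃ k, D k, maxOn 𝒢 A x ^ e ∂ν := lintegral_indicator (.iUnion hDm) _
    _ ≤ ∑' k, ∫⁻ x in D k, maxOn 𝒢 A x ^ e ∂ν := lintegral_iUnion_le _ _
    _ ≤ ∑' k, 2 ^ e * K * (I ^ (θ - 1) *
          (2 * (∫⁻ x in D k, H x ∂μ + ∫⁻ x in D (k + 1), H x ∂μ))) := by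
        refine ENNReal.tsum_le_tsum fun k => (hlayer k).trans ?_
        gcongr
        exact hlayer' k
    _ = 2 ^ e * K * (I ^ (θ - 1) * (2 * (∑' k, ∫⁻ x in D k, H x ∂μ
          + ∑' k, ∫⁻ x in D (k + 1), H x ∂μ))) := by
        rw [ENNReal.tsum_mul_left, ENNReal.tsum_mul_left, ENNReal.tsum_mul_left, ENNReal.tsum_add]
    _ ≤ 2 ^ e * K * (I ^ (θ - 1) * (2 * (I + I))) := by gcongr
    _ = 2 ^ e * K * (4 * (I ^ (θ - 1) * I)) := by ring
    _ = _ := by rw [rpow_sub_one_mul_self _ hθ]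

end Carleson

/-! ### Young functions, associates and the condition `B_p`. -/

section Young

variable {Φ Ψ : ℝ → ℝ}

lemma IsAssociate.nonneg (h : IsAssociate Φ Ψ) {b : ℝ} (hb : 0 ≤ b) : 0 ≤ Ψ b := by
  have := h.monotoneOn (mem_Ici.2 le_rfl) (mem_Ici.2 hb) hb
  rwa [h.map_zero] at this

lemma IsYoung.nonneg (h : IsYoung Φ) {b : ℝ} (hb : 0 ≤ b) : 0 ≤ Φ b := by
  have := h.strictMonoOn.monotoneOn (mem_Ici.2 le_rfl) (mem_Ici.2 hb) hb
  rwa [h.map_zero] at this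

lemma inv_nonneg (Φ : ℝ → ℝ) (t : ℝ) : 0 ≤ inv Φ t :=
  Real.sSup_nonneg fun _ hs => hs.1

lemma IsAssociate.inv_pos (h : IsAssociate Φ Ψ) {t : ℝ} (ht : 0 < t) :
    0 < inv Φ t ∧ 0 < inv Ψ t := by
  have h1 := ht.trans_le (h.le_inv_mul_inv t ht)
  exact ⟨pos_of_mul_pos_left h1 (inv_nonneg _ _), pos_of_mul_pos_right h1 (inv_nonneg _ _)⟩

/-- Real `sSup` of an unbounded set is `0`, so positivity of `inv Φ t` is what certifies
boundedness. -/
lemma le_inv {t s : ℝ} (ht : 0 < inv Φ t) (hs : 0 ≤ s) (hst : Φ s ≤ t) : s ≤ inv Φ t := by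
  refine le_csSup ?_ ⟨hs, hst⟩
  by_contra hb
  rw [inv, Real.sSup_of_not_bddAbove hb] at ht
  exact lt_irrefl _ ht

/-- Young's inequality, up to the factor `2`. -/
lemma IsAssociate.mul_le (h : IsAssociate Φ Ψ) (hΦ : IsYoung Φ) {a b : ℝ} (ha : 0 ≤ a)
    (hb : 0 ≤ b) : a * b ≤ 2 * (Φ a + Ψ b) := by
  have hΦa := hΦ.nonneg ha
  have hΨb := h.nonneg hb
  rcases ha.eq_or_lt with rfl | ha'
  · rw [zero_mul]; positivity
  · have hpos : 0 < Φ a := by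
      have := hΦ.strictMonoOn (mem_Ici.2 le_rfl) (mem_Ici.2 ha) ha'
      rwa [hΦ.map_zero] at this
    have ht : 0 < Φ a + Ψ b := by linarith
    obtain ⟨h1, h2⟩ := h.inv_pos ht
    calc a * b ≤ inv Φ (Φ a + Ψ b) * inv Ψ (Φ a + Ψ b) :=
          mul_le_mul (le_inv h1 ha (by linarith)) (le_inv h2 hb (by linarith)) hb h1.le
      _ ≤ _ := h.inv_mul_inv_le _ ht

/-- If `Ψ` were nowhere positive, the set defining `inv Ψ 1` would be unbounded, which contradicts
`inv Ψ 1 > 0`. -/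
lemma IsAssociate.exists_pos (h : IsAssociate Φ Ψ) : ∃ M, 0 < M ∧ 0 < Ψ M := by
  by_contra hcon
  push Not at hcon
  obtain ⟨-, h2⟩ := h.inv_pos one_pos
  have h3 : inv Ψ 1 + 1 ≤ inv Ψ 1 :=
    le_inv h2 (by linarith) ((hcon _ (by linarith)).trans zero_le_one)
  linarith

/-- A convex function vanishing at `0` and positive somewhere grows at least linearly. -/
lemma exists_le_mul_one_add (hc : ConvexOn ℝ (Ici 0) Φ) (h0 : Φ 0 = 0)
    (hnn : ∀ x, 0 ≤ x → 0 ≤ Φ x) (hpos : ∃ M, 0 < M ∧ 0 < Φ M) :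
    ∃ C : NNReal, ∀ a : ℝ, 0 ≤ a → a ≤ C * (1 + Φ a) := by
  obtain ⟨M, hM, hΦM⟩ := hpos
  have hC : 0 ≤ M + M / Φ M := by positivity
  refine ⟨⟨M + M / Φ M, hC⟩, fun a ha => ?_⟩
  change a ≤ (M + M / Φ M) * (1 + Φ a)
  have hΦa := hnn a ha
  rcases le_or_gt a M with h | h
  · nlinarith [mul_nonneg hC hΦa, div_pos hM hΦM]
  · have ha' : 0 < a := hM.trans h
    have hMa : 0 ≤ 1 - M / a := by rw [sub_nonneg, div_le_one ha']; exact h.le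
    have := hc.2 (mem_Ici.2 le_rfl) (mem_Ici.2 ha) hMa (by positivity : 0 ≤ M / a) (by ring)
    simp only [smul_eq_mul, mul_zero, zero_add, h0, div_mul_cancel₀ _ ha'.ne'] at this
    have h2 : a ≤ M / Φ M * Φ a := by
      rw [div_mul_eq_mul_div, le_div_iff₀ hΦM]
      calc a * Φ M ≤ a * (M / a * Φ a) := by gcongr
        _ = M * Φ a := by field_simp
    nlinarith [mul_nonneg hC hΦa, div_pos hM hΦM, mul_nonneg hM.le hΦa]

/-- The `B_p` condition bounds a nondecreasing function by a power. -/
lemma MemB.exists_le_rpow {p : ℝ} (hp : 0 < p) (hB : MemB p Ψ) (hmono : MonotoneOn Ψ (Ici 0))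
    (h0 : Ψ 0 = 0) : ∃ C c : ℝ, 0 < C ∧ 0 < c ∧ ∀ b, c ≤ b → Ψ b ≤ C * b ^ p := by
  obtain ⟨c, hc, hint⟩ := hB
  have hnn : ∀ x, 0 ≤ x → 0 ≤ Ψ x := fun x hx => by
    have := hmono (mem_Ici.2 le_rfl) (mem_Ici.2 hx) hx
    rwa [h0] at this
  set I := ∫ t in Ioi c, Ψ t / t ^ (p + 1) with hI
  have hI0 : 0 ≤ I := setIntegral_nonneg measurableSet_Ioi fun t ht => by
    have ht' : 0 < t := hc.trans ht
    exact div_nonneg (hnn t ht'.le) (by positivity)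
  refine ⟨(I + 1) * 2 ^ (p + 1), c, by positivity, hc, fun b hb => ?_⟩
  have hb0 : 0 < b := hc.trans_le hb
  have hsub : Ioc b (2 * b) ⊆ Ioi c := fun t ht => hb.trans_lt ht.1
  -- On `(b, 2b]` the integrand is at least `Ψ b / (2b)^(p+1)`, by monotonicity.
  have h1 : Ψ b / (2 * b) ^ (p + 1) * b ≤ I := by
    calc Ψ b / (2 * b) ^ (p + 1) * b = ∫ _ in Ioc b (2 * b), Ψ b / (2 * b) ^ (p + 1) := by
          rw [setIntegral_const, smul_eq_mul, Measure.real, Real.volume_Ioc,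
            ENNReal.toReal_ofReal (by linarith)]
          ring
      _ ≤ ∫ t in Ioc b (2 * b), Ψ t / t ^ (p + 1) := by
          refine setIntegral_mono_on (integrableOn_const (by simp)) (hint.mono_set hsub)
            measurableSet_Ioc fun t ht => ?_
          have ht0 : 0 < t := hb0.trans ht.1
          exact div_le_div₀ (hnn t ht0.le) (hmono (mem_Ici.2 hb0.le) (mem_Ici.2 ht0.le) ht.1.le)
            (by positivity) (Real.rpow_le_rpow ht0.le ht.2 (by linarith))
      _ ≤ I := by
          refine setIntegral_mono_set hint ?_ hsub.eventuallyLE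
          filter_upwards [ae_restrict_mem measurableSet_Ioi] with t ht
          have ht' : 0 < t := hc.trans ht
          exact div_nonneg (hnn t ht'.le) (by positivity)
  rw [Real.mul_rpow (by simp) hb0.le, Real.rpow_add_one hb0.ne', div_mul_eq_mul_div,
    div_le_iff₀ (by positivity)] at h1
  have h2 : Ψ b * b ≤ (I * 2 ^ (p + 1) * b ^ p) * b := by linarith
  have h3 := le_of_mul_le_mul_right h2 hb0
  have h4 : 0 ≤ (2 : ℝ) ^ (p + 1) * b ^ p := by positivity
  nlinarith

/-- If an associate function of `Φ` is in `B_{q'}`, then `Φ` dominates the power `q`. -/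
lemma IsAssociate.exists_rpow_le (h : IsAssociate Φ Ψ) (hΦ : IsYoung Φ) {q : ℝ} (hq : 1 < q)
    (hB : MemB (q / (q - 1)) Ψ) : ∃ C : NNReal, ∀ a : ℝ, 0 ≤ a → a ^ q ≤ C * (1 + Φ a) := by
  have hq1 : 0 < q - 1 := by linarith
  obtain ⟨C, c, hC, hc, hΨ⟩ := hB.exists_le_rpow (by positivity) h.monotoneOn h.map_zero
  -- Young's inequality is applied to `a` and `b = ε a^(q-1)`. This `ε` solves `C ε^(q/(q-1)) =
  -- ε/4`, so `2 Ψ b ≤ ε a^q / 2` is absorbed into `a b = ε a^q`. If `b < c`, the power bound on `Ψ`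
  -- is unavailable, but then `a` is bounded.
  set ε : ℝ := (1 / (4 * C)) ^ (q - 1) with hε
  have hεpos : 0 < ε := by positivity
  have hε' : ε ^ (q / (q - 1)) = ε * (1 / (4 * C)) := by
    rw [hε, ← Real.rpow_mul (by positivity), mul_div_cancel₀ _ hq1.ne',
      ← Real.rpow_add_one (by positivity), sub_add_cancel]
  have hK : 0 ≤ (c / ε) ^ (q / (q - 1)) + 4 / ε := by positivity
  refine ⟨⟨_, hK⟩, fun a ha => ?_⟩
  change a ^ q ≤ ((c / ε) ^ (q / (q - 1)) + 4 / ε) * (1 + Φ a)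
  have hΦa := hΦ.nonneg ha
  have haq : (a ^ (q - 1)) ^ (q / (q - 1)) = a ^ q := by
    rw [← Real.rpow_mul ha, mul_div_cancel₀ _ hq1.ne']
  have hcase : a ^ q ≤ (c / ε) ^ (q / (q - 1)) ∨ a ^ q ≤ 4 / ε * Φ a := by
    rcases le_or_gt c (ε * a ^ (q - 1)) with hb | hb
    · right
      have h1 := h.mul_le hΦ ha (b := ε * a ^ (q - 1)) (by positivity)
      have h2 := hΨ _ hb
      rw [Real.mul_rpow hεpos.le (by positivity), haq, hε'] at h2
      have h3 : a * (ε * a ^ (q - 1)) = ε * a ^ q := by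
        rcases ha.eq_or_lt with rfl | ha'
        · rw [Real.zero_rpow (by linarith), Real.zero_rpow (by linarith)]; ring
        · rw [Real.rpow_sub_one ha'.ne']; field_simp
      have h4 : C * (ε * (1 / (4 * C)) * a ^ q) = ε * a ^ q / 4 := by field_simp
      rw [h3] at h1
      rw [h4] at h2
      rw [div_mul_eq_mul_div, le_div_iff₀ hεpos]
      linarith
    · left
      rw [← haq]
      refine Real.rpow_le_rpow (by positivity) ?_ (by positivity)
      rw [le_div_iff₀ hεpos]
      linarith
  have h5 : 0 ≤ (c / ε) ^ (q / (q - 1)) := by positivity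
  have h6 : 0 ≤ 4 / ε := by positivity
  rcases hcase with h7 | h7 <;> nlinarith [mul_nonneg h5 hΦa, mul_nonneg h6 hΦa]

end Young

/-! ### Extension of these inequalities to the value `∞`. -/

section Ext

variable {Φ Ψ : ℝ → ℝ}

lemma ext_ofReal (Φ : ℝ → ℝ) {t : ℝ} (ht : 0 ≤ t) :
    ext Φ (ENNReal.ofReal t) = ENNReal.ofReal (Φ t) := by
  rw [ext, if_neg ENNReal.ofReal_ne_top, ENNReal.toReal_ofReal ht]

lemma ext_top (Φ : ℝ → ℝ) : ext Φ ∞ = ∞ := if_pos rfl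

lemma ext_mono (h : MonotoneOn Φ (Ici 0)) : Monotone (ext Φ) := by
  intro x y hxy
  rcases eq_or_ne y ∞ with rfl | hy
  · rw [ext_top]; exact le_top
  · have hx : x ≠ ∞ := ne_top_of_le_ne_top hy hxy
    rw [ext, ext, if_neg hx, if_neg hy]
    exact ENNReal.ofReal_le_ofReal (h (mem_Ici.2 ENNReal.toReal_nonneg)
      (mem_Ici.2 ENNReal.toReal_nonneg) (ENNReal.toReal_mono hy hxy))

lemma measurable_ext (h : MonotoneOn Φ (Ici 0)) : Measurable (ext Φ) := (ext_mono h).measurable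

lemma IsAssociate.mul_le_ext (h : IsAssociate Φ Ψ) (hΦ : IsYoung Φ) (x y : ℝ≥0∞) :
    x * y ≤ 2 * (ext Ψ x + ext Φ y) := by
  rcases eq_or_ne x ∞ with rfl | hx
  · simp [ext_top]
  rcases eq_or_ne y ∞ with rfl | hy
  · simp [ext_top]
  lift x to NNReal using hx
  lift y to NNReal using hy
  have h1 := h.mul_le hΦ y.2 x.2
  rw [← ENNReal.ofReal_coe_nnreal, ← ENNReal.ofReal_coe_nnreal (p := y),
    ext_ofReal _ x.coe_nonneg, ext_ofReal _ y.coe_nonneg, ← ENNReal.ofReal_mul x.coe_nonneg,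
    ← ENNReal.ofReal_add (h.nonneg x.coe_nonneg) (hΦ.nonneg y.coe_nonneg),
    show (2 : ℝ≥0∞) = ENNReal.ofReal 2 by simp, ← ENNReal.ofReal_mul (by simp)]
  refine ENNReal.ofReal_le_ofReal ?_
  rw [mul_comm, add_comm]
  exact h1

/-- The constant `C + 1` is nonzero even if `C = 0`, so the right side is `∞` at `x = ∞`. -/
lemma rpow_le_ext {e : ℝ} (he : 0 < e) (hnn : ∀ x, 0 ≤ x → 0 ≤ Φ x) {C : NNReal}
    (hC : ∀ a : ℝ, 0 ≤ a → a ^ e ≤ C * (1 + Φ a)) (x : ℝ≥0∞) :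
    x ^ e ≤ ((C + 1 : NNReal) : ℝ≥0∞) * (1 + ext Φ x) := by
  rcases eq_or_ne x ∞ with rfl | hx
  · simp [ext_top]
  lift x to NNReal using hx
  rw [← ENNReal.ofReal_coe_nnreal, ext_ofReal _ x.coe_nonneg, ENNReal.ofReal_rpow_of_nonneg x.coe_nonneg he.le,
    show (1 : ℝ≥0∞) = ENNReal.ofReal 1 by simp, ← ENNReal.ofReal_add (by simp) (hnn _ x.coe_nonneg),
    ← ENNReal.ofReal_coe_nnreal, ← ENNReal.ofReal_mul (by positivity)]
  refine ENNReal.ofReal_le_ofReal ((hC x x.2).trans ?_)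
  have := hnn x x.2
  push_cast
  nlinarith

end Ext

/-! ### Orlicz averages and their Hölder inequality. -/

section Orlicz

variable {n : ℕ} {Φ Ψ : ℝ → ℝ} {Q : Set (Fin n → ℝ)} {F W : (Fin n → ℝ) → ℝ≥0∞}

lemma orliczAvg_lt_iff {b : ℝ≥0∞} : orliczAvg Φ Q F < b ↔ ∃ c : ℝ, 0 < c ∧
    ⨍⁻ x in Q, ext Φ (F x / ENNReal.ofReal c) ∂volume ≤ 1 ∧ ENNReal.ofReal c < b := by
  simp only [orliczAvg, iInf_lt_iff, exists_prop]

lemma one_lt_of_lt_orliczAvg {t : ℝ} (ht : 0 < t) (h : ENNReal.ofReal t < orliczAvg Φ Q F) :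
    1 < ⨍⁻ x in Q, ext Φ (F x / ENNReal.ofReal t) ∂volume := by
  by_contra hcon
  exact absurd h (not_lt.2 (iInf₂_le_of_le t ht (iInf_le_of_le (not_lt.1 hcon) le_rfl)))

lemma orliczAvg_congr_ae (h : F =ᵐ[volume] W) : orliczAvg Φ Q F = orliczAvg Φ Q W := by
  have : ∀ c : ℝ, ⨍⁻ x in Q, ext Φ (F x / ENNReal.ofReal c) ∂volume
      = ⨍⁻ x in Q, ext Φ (W x / ENNReal.ofReal c) ∂volume := fun c => by
    rw [setLAverage_eq, setLAverage_eq]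
    congr 1
    refine lintegral_congr_ae (ae_restrict_of_ae ?_)
    filter_upwards [h] with x hx
    rw [hx]
  simp only [orliczAvg, this]

lemma setLAverage_const_mul {c : ℝ≥0∞} (hc : c ≠ ∞) (F : (Fin n → ℝ) → ℝ≥0∞) :
    ⨍⁻ x in Q, c * F x ∂volume = c * ⨍⁻ x in Q, F x ∂volume := by
  rw [setLAverage_eq, setLAverage_eq, lintegral_const_mul' _ _ hc, mul_div_assoc]

lemma setLAverage_mono {F W : (Fin n → ℝ) → ℝ≥0∞} (h : ∀ x, F x ≤ W x) :
    ⨍⁻ x in Q, F x ∂volume ≤ ⨍⁻ x in Q, W x ∂volume := by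
  rw [setLAverage_eq, setLAverage_eq]
  gcongr
  exact h _

/-- An Orlicz average dominates the power average if the Young function dominates the power. -/
lemma setLAverage_rpow_le {e : ℝ} (he : 0 < e) (hmono : MonotoneOn Φ (Ici 0)) (h0 : Φ 0 = 0)
    {C : NNReal} (hC : ∀ a : ℝ, 0 ≤ a → a ^ e ≤ C * (1 + Φ a))
    (hQ0 : volume Q ≠ 0) (hQ : volume Q ≠ ∞) :
    ⨍⁻ x in Q, F x ^ e ∂volume ≤ ((2 * (C + 1) : NNReal) : ℝ≥0∞) * orliczAvg Φ Q F ^ e := by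
  have hnn : ∀ x, 0 ≤ x → 0 ≤ Φ x := fun x hx => by
    have := hmono (mem_Ici.2 le_rfl) (mem_Ici.2 hx) hx
    rwa [h0] at this
  have key : ∀ c : ℝ, 0 < c → ⨍⁻ x in Q, ext Φ (F x / ENNReal.ofReal c) ∂volume ≤ 1 →
      ⨍⁻ x in Q, F x ^ e ∂volume ≤ ((2 * (C + 1) : NNReal) : ℝ≥0∞) * ENNReal.ofReal c ^ e := by
    intro c hc h1
    have hc0 : ENNReal.ofReal c ≠ 0 := by simpa using hc
    have hce : ENNReal.ofReal c ^ e ≠ ∞ := ENNReal.rpow_ne_top_of_nonneg he.le (by simp)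
    calc ⨍⁻ x in Q, F x ^ e ∂volume
        ≤ ⨍⁻ x in Q, ENNReal.ofReal c ^ e * (((C + 1 : NNReal) : ℝ≥0∞)
            * (1 + ext Φ (F x / ENNReal.ofReal c))) ∂volume := by
          refine setLAverage_mono fun x => ?_
          calc F x ^ e = ENNReal.ofReal c ^ e * (F x / ENNReal.ofReal c) ^ e := by
                rw [← ENNReal.mul_rpow_of_nonneg _ _ he.le,
                  ENNReal.mul_div_cancel hc0 ENNReal.ofReal_ne_top]
            _ ≤ _ := by gcongr; exact rpow_le_ext he hnn hC _
      _ = ENNReal.ofReal c ^ e * (((C + 1 : NNReal) : ℝ≥0∞)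
            * (1 + ⨍⁻ x in Q, ext Φ (F x / ENNReal.ofReal c) ∂volume)) := by
          rw [setLAverage_const_mul hce, setLAverage_const_mul ENNReal.coe_ne_top]
          congr 2
          rw [setLAverage_eq, setLAverage_eq, lintegral_add_left measurable_const,
            setLIntegral_const, one_mul, ENNReal.add_div, ENNReal.div_self hQ0 hQ]
      _ ≤ ENNReal.ofReal c ^ e * (((C + 1 : NNReal) : ℝ≥0∞) * (1 + 1)) := by gcongr
      _ = _ := by push_cast; ring
  rcases eq_or_ne (orliczAvg Φ Q F) ∞ with htop | htop
  · rw [htop, ENNReal.top_rpow_of_pos he, ENNReal.mul_top]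
    · exact le_top
    · simp
  have hK : ((2 * (C + 1) : NNReal) : ℝ≥0∞) ≠ 0 := by simp
  -- The bound holds for each admissible `c`. Solving it for `c` lets one pass to the infimum.
  rw [← ENNReal.div_le_iff' hK ENNReal.coe_ne_top, ← ENNReal.rpow_inv_le_iff he]
  refine le_of_forall_gt fun b hb => ?_
  obtain ⟨c, hc, h1, hcb⟩ := orliczAvg_lt_iff.1 hb
  refine lt_of_le_of_lt ?_ hcb
  rw [ENNReal.rpow_inv_le_iff he, ENNReal.div_le_iff' hK ENNReal.coe_ne_top]
  exact key c hc h1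

/-- At least linear growth of `Φ` makes the Orlicz average control the mean of `F`, which then
vanishes. -/
lemma ae_eq_zero_of_orliczAvg_eq_zero (hmono : MonotoneOn Φ (Ici 0)) (h0 : Φ 0 = 0)
    (hc : ConvexOn ℝ (Ici 0) Φ) (hpos : ∃ M, 0 < M ∧ 0 < Φ M)
    (hQ0 : volume Q ≠ 0) (hQ : volume Q ≠ ∞) (hF : AEMeasurable F volume)
    (h : orliczAvg Φ Q F = 0) : ∀ᵐ x ∂volume.restrict Q, F x = 0 := by
  have hnn : ∀ x, 0 ≤ x → 0 ≤ Φ x := fun x hx => by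
    have := hmono (mem_Ici.2 le_rfl) (mem_Ici.2 hx) hx
    rwa [h0] at this
  obtain ⟨C, hC⟩ := exists_le_mul_one_add hc h0 hnn hpos
  have h1 := setLAverage_rpow_le (F := F) one_pos hmono h0 (C := C) (by simpa using hC) hQ0 hQ
  simp only [ENNReal.rpow_one] at h1
  rw [h, mul_zero, setLAverage_eq, nonpos_iff_eq_zero, ENNReal.div_eq_zero_iff] at h1
  exact (lintegral_eq_zero_iff' hF.restrict).1 (h1.resolve_right hQ)

/-- Hölder's inequality for Orlicz averages. -/
lemma IsAssociate.setLAverage_mul_le (h : IsAssociate Φ Ψ) (hΦ : IsYoung Φ)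
    (hQ0 : volume Q ≠ 0) (hQ : volume Q ≠ ∞) (hF : AEMeasurable F volume)
    (hW : AEMeasurable W volume) :
    ⨍⁻ x in Q, F x * W x ∂volume ≤ 4 * (orliczAvg Ψ Q F * orliczAvg Φ Q W) := by
  -- A vanishing average needs its own argument: if the other average is `∞`, the product `0 * ∞ =
  -- 0` is not approximated by products of larger admissible constants.
  by_cases hF0 : orliczAvg Ψ Q F = 0
  · have := ae_eq_zero_of_orliczAvg_eq_zero h.monotoneOn h.map_zero h.convexOn h.exists_pos
      hQ0 hQ hF hF0
    have h2 : ∫⁻ x in Q, F x * W x ∂volume = 0 := by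
      refine (lintegral_congr_ae ?_).trans lintegral_zero
      filter_upwards [this] with x hx
      simp [hx]
    simp [setLAverage_eq, h2]
  by_cases hW0 : orliczAvg Φ Q W = 0
  · have := ae_eq_zero_of_orliczAvg_eq_zero hΦ.strictMonoOn.monotoneOn hΦ.map_zero hΦ.convexOn
      ⟨1, one_pos, by
        have := hΦ.strictMonoOn (mem_Ici.2 le_rfl) (mem_Ici.2 zero_le_one) one_pos
        rwa [hΦ.map_zero] at this⟩ hQ0 hQ hW hW0
    have h2 : ∫⁻ x in Q, F x * W x ∂volume = 0 := by
      refine (lintegral_congr_ae ?_).trans lintegral_zero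
      filter_upwards [this] with x hx
      simp [hx]
    simp [setLAverage_eq, h2]
  rw [← ENNReal.div_le_iff' (by simp) (by simp)]
  refine ENNReal.le_mul_of_forall_lt (Or.inl hF0) (Or.inr hW0) fun a ha b hb => ?_
  obtain ⟨c, hc, hc1, hca⟩ := orliczAvg_lt_iff.1 ha
  obtain ⟨d, hd, hd1, hdb⟩ := orliczAvg_lt_iff.1 hb
  have hc0 : ENNReal.ofReal c ≠ 0 := by simpa using hc
  have hd0 : ENNReal.ofReal d ≠ 0 := by simpa using hd
  rw [ENNReal.div_le_iff' (by simp) (by simp)]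
  calc ⨍⁻ x in Q, F x * W x ∂volume
      ≤ ⨍⁻ x in Q, (ENNReal.ofReal c * ENNReal.ofReal d * 2) *
          (ext Ψ (F x / ENNReal.ofReal c) + ext Φ (W x / ENNReal.ofReal d)) ∂volume := by
        refine setLAverage_mono fun x => ?_
        calc F x * W x = (ENNReal.ofReal c * (F x / ENNReal.ofReal c))
              * (ENNReal.ofReal d * (W x / ENNReal.ofReal d)) := by
              rw [ENNReal.mul_div_cancel hc0 ENNReal.ofReal_ne_top,
                ENNReal.mul_div_cancel hd0 ENNReal.ofReal_ne_top]
          _ = ENNReal.ofReal c * ENNReal.ofReal d *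
              ((F x / ENNReal.ofReal c) * (W x / ENNReal.ofReal d)) := by ring
          _ ≤ ENNReal.ofReal c * ENNReal.ofReal d *
              (2 * (ext Ψ (F x / ENNReal.ofReal c) + ext Φ (W x / ENNReal.ofReal d))) := by
              gcongr ENNReal.ofReal c * ENNReal.ofReal d * ?_; exact h.mul_le_ext hΦ _ _
          _ = _ := by ring
    _ = (ENNReal.ofReal c * ENNReal.ofReal d * 2) *
          (⨍⁻ x in Q, ext Ψ (F x / ENNReal.ofReal c) ∂volume
            + ⨍⁻ x in Q, ext Φ (W x / ENNReal.ofReal d) ∂volume) := by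
        rw [setLAverage_const_mul (by finiteness)]
        congr 1
        rw [setLAverage_eq, setLAverage_eq, setLAverage_eq, ← ENNReal.add_div, lintegral_add_left']
        exact ((measurable_ext h.monotoneOn).comp_aemeasurable (hF.div_const _)).restrict
    _ ≤ (ENNReal.ofReal c * ENNReal.ofReal d * 2) * (1 + 1) := by gcongr
    _ = 4 * (ENNReal.ofReal c * ENNReal.ofReal d) := by ring
    _ ≤ 4 * (a * b) := by gcongr

end Orlicz

/-! ### Layer cake and scaling of the kernel integral. -/

section LayerCake

/-- The layer cake formula for a single value. -/
lemma rpow_le_lintegral_indicator {ρ : ℝ} (hρ : 0 < ρ) (x : ℝ≥0∞) :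
    x ^ ρ ≤ ∫⁻ t in Ioi (0 : ℝ), ENNReal.ofReal (ρ * t ^ (ρ - 1)) *
      {t : ℝ | ENNReal.ofReal t < x}.indicator (fun _ => 1) t := by
  have key : ∀ r : NNReal, (r : ℝ≥0∞) ≤ x → (r : ℝ≥0∞) ^ ρ ≤ ∫⁻ t in Ioi (0 : ℝ),
      ENNReal.ofReal (ρ * t ^ (ρ - 1)) * {t : ℝ | ENNReal.ofReal t < x}.indicator (fun _ => 1) t := by
    intro r hr
    have hint : ∫ t in (0 : ℝ)..r, ρ * t ^ (ρ - 1) = (r : ℝ) ^ ρ := by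
      rw [intervalIntegral.integral_const_mul, integral_rpow (Or.inl (by linarith)), sub_add_cancel,
        Real.zero_rpow hρ.ne', sub_zero, mul_div_cancel₀ _ hρ.ne']
    have hii : IntervalIntegrable (fun t : ℝ => ρ * t ^ (ρ - 1)) volume 0 r :=
      (intervalIntegral.intervalIntegrable_rpow' (by linarith)).const_mul _
    calc (r : ℝ≥0∞) ^ ρ = ENNReal.ofReal ((r : ℝ) ^ ρ) := by
          rw [← ENNReal.ofReal_coe_nnreal, ENNReal.ofReal_rpow_of_nonneg r.coe_nonneg hρ.le]
      _ = ∫⁻ t in Ioc (0 : ℝ) r, ENNReal.ofReal (ρ * t ^ (ρ - 1)) := by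
          rw [← hint, intervalIntegral.integral_of_le r.coe_nonneg,
            ofReal_integral_eq_lintegral_ofReal
              ((intervalIntegrable_iff_integrableOn_Ioc_of_le r.coe_nonneg).1 hii)]
          filter_upwards [ae_restrict_mem measurableSet_Ioc] with t ht
          have : 0 < t := ht.1
          positivity
      _ = ∫⁻ t in Ioo (0 : ℝ) r, ENNReal.ofReal (ρ * t ^ (ρ - 1)) :=
          setLIntegral_congr Ioo_ae_eq_Ioc.symm
      _ ≤ ∫⁻ t in Ioo (0 : ℝ) r, ENNReal.ofReal (ρ * t ^ (ρ - 1)) *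
            {t : ℝ | ENNReal.ofReal t < x}.indicator (fun _ => 1) t := by
          refine setLIntegral_mono' measurableSet_Ioo fun t ht => ?_
          have htx : t ∈ {t : ℝ | ENNReal.ofReal t < x} := by
            refine lt_of_lt_of_le ?_ hr
            rw [← ENNReal.ofReal_coe_nnreal]
            exact (ENNReal.ofReal_lt_ofReal_iff (ht.1.trans ht.2)).2 ht.2
          rw [indicator_of_mem htx, mul_one]
      _ ≤ _ := lintegral_mono_set Ioo_subset_Ioi_self
  rcases eq_or_ne x ∞ with rfl | hx
  · rw [ENNReal.top_rpow_of_pos hρ, top_le_iff]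
    refine ENNReal.eq_top_of_forall_nnreal_le fun r => ?_
    refine le_trans (le_of_eq ?_) (key (r ^ ρ⁻¹) le_top)
    rw [← ENNReal.coe_rpow_of_nonneg _ hρ.le, ← NNReal.rpow_mul, inv_mul_cancel₀ hρ.ne',
      NNReal.rpow_one]
  · lift x to NNReal using hx
    exact key x le_rfl

/-- The substitution `t = r / s`. -/
lemma lintegral_Ioi_comp_div {r : ℝ} (hr : 0 < r) (g : ℝ → ℝ≥0∞) :
    ∫⁻ t in Ioi (0 : ℝ), g t = ∫⁻ s in Ioi (0 : ℝ), ENNReal.ofReal (r / s ^ 2) * g (r / s) := by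
  have himg : (fun s : ℝ => r / s) '' Ioi 0 = Ioi 0 := by
    ext t
    constructor
    · rintro ⟨s, hs, rfl⟩
      exact div_pos hr hs
    · intro ht
      have ht' : 0 < t := ht
      exact ⟨r / t, div_pos hr ht, by field_simp⟩
  have h := lintegral_image_eq_lintegral_abs_deriv_mul (s := Ioi (0 : ℝ)) (f := fun s => r / s)
    (f' := fun s => -(r / s ^ 2)) measurableSet_Ioi (fun s hs => by
      have hs' : s ≠ 0 := ne_of_gt hs
      have := ((hasDerivAt_inv hs').const_mul r).hasDerivWithinAt (s := Ioi 0)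
      simpa [div_eq_mul_inv] using this)
    (fun a ha b hb hab => by
      have ha' : a ≠ 0 := ne_of_gt ha
      have hb' : b ≠ 0 := ne_of_gt hb
      have : r / a = r / b := hab
      field_simp at this
      exact this.symm) g
  rw [himg] at h
  rw [h]
  refine setLIntegral_congr_fun measurableSet_Ioi fun s hs => ?_
  have hs' : 0 < s := hs
  rw [abs_neg, abs_of_pos (by positivity)]

/-- Scaling of a logarithmic convolution, for a kernel `G` vanishing at `0`. -/
lemma lintegral_rpow_mul_comp_div_le {ρ : ℝ} (hρ : 0 < ρ) (G : ℝ≥0∞ → ℝ≥0∞) (hG0 : G 0 = 0)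
    {C : ℝ≥0∞} (hC0 : C ≠ 0)
    (hC : ∫⁻ s in Ioi (0 : ℝ), ENNReal.ofReal (ρ / s ^ (ρ + 1)) * G (ENNReal.ofReal s) ≤ C)
    (y : ℝ≥0∞) :
    ∫⁻ t in Ioi (0 : ℝ), ENNReal.ofReal (ρ * t ^ (ρ - 1)) * G (y / ENNReal.ofReal t)
      ≤ C * y ^ ρ := by
  rcases eq_or_ne y ∞ with rfl | hy
  · rw [ENNReal.top_rpow_of_pos hρ, ENNReal.mul_top hC0]
    exact le_top
  rcases eq_or_ne y 0 with rfl | hy0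
  · simp [hG0]
  obtain ⟨r, hr, rfl⟩ : ∃ r : ℝ, 0 < r ∧ y = ENNReal.ofReal r :=
    ⟨y.toReal, ENNReal.toReal_pos hy0 hy, (ENNReal.ofReal_toReal hy).symm⟩
  rw [lintegral_Ioi_comp_div hr, mul_comm, ENNReal.ofReal_rpow_of_pos hr]
  calc _ = ∫⁻ s in Ioi (0 : ℝ), ENNReal.ofReal (r ^ ρ) *
        (ENNReal.ofReal (ρ / s ^ (ρ + 1)) * G (ENNReal.ofReal s)) := by
        refine setLIntegral_congr_fun measurableSet_Ioi fun s hs => ?_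
        have hs' : 0 < s := hs
        rw [← ENNReal.ofReal_div_of_pos (by positivity), div_div_cancel₀ hr.ne', ← mul_assoc,
          ← mul_assoc, ← ENNReal.ofReal_mul (by positivity), ← ENNReal.ofReal_mul (by positivity)]
        congr 2
        rw [Real.div_rpow hr.le hs'.le, Real.rpow_sub_one hr.ne', Real.rpow_sub_one hs'.ne',
          Real.rpow_add_one hs'.ne']
        field_simp
    _ = ENNReal.ofReal (r ^ ρ) * ∫⁻ s in Ioi (0 : ℝ),
        (ENNReal.ofReal (ρ / s ^ (ρ + 1)) * G (ENNReal.ofReal s)) :=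
        lintegral_const_mul' _ _ ENNReal.ofReal_ne_top
    _ ≤ _ := by gcongr

end LayerCake

/-! ### Strong type bounds for Orlicz maximal functions. -/

section OrliczMaximal

variable {n : ℕ} {Φ : ℝ → ℝ}

/-- Weak type estimate on the maximal sets of a superlevel set. -/
lemma volume_le_of_lt_orliczAvg {G : ℝ≥0∞ → ℝ≥0∞} (hG : ∀ y, ext Φ y ≤ G y + 2⁻¹)
    {Q : Set (Fin n → ℝ)} (hQ0 : volume Q ≠ 0) (hQ : volume Q ≠ ∞) {F : (Fin n → ℝ) → ℝ≥0∞}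
    {t : ℝ} (ht : 0 < t) (h : ENNReal.ofReal t < orliczAvg Φ Q F) :
    volume Q ≤ 2 * ∫⁻ x in Q, G (F x / ENNReal.ofReal t) := by
  have h1 := one_lt_of_lt_orliczAvg ht h
  rw [setLAverage_eq, ENNReal.lt_div_iff_mul_lt (Or.inl hQ0) (Or.inl hQ), one_mul] at h1
  have h2 : volume Q ≤ (∫⁻ x in Q, G (F x / ENNReal.ofReal t)) + 2⁻¹ * volume Q := by
    calc volume Q ≤ ∫⁻ x in Q, ext Φ (F x / ENNReal.ofReal t) := h1.le
      _ ≤ ∫⁻ x in Q, (G (F x / ENNReal.ofReal t) + 2⁻¹) := lintegral_mono fun x => hG _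
      _ = _ := by rw [lintegral_add_right _ measurable_const, setLIntegral_const]
  have h3 : 2⁻¹ * volume Q + 2⁻¹ * volume Q = volume Q := by
    rw [← add_mul, ENNReal.inv_two_add_inv_two, one_mul]
  have h4 : 2⁻¹ * volume Q ≤ ∫⁻ x in Q, G (F x / ENNReal.ofReal t) := by
    rw [← ENNReal.add_le_add_iff_right (show 2⁻¹ * volume Q ≠ ∞ by finiteness), h3]
    exact h2
  calc volume Q = 2 * (2⁻¹ * volume Q) := by
        rw [← mul_assoc, ENNReal.mul_inv_cancel (by simp) (by simp), one_mul]
    _ ≤ _ := by gcongr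

/-- `B_ρ` controls only the tail of `Φ`, so `G` is `Φ` cut off below some `ε` with `Φ ε ≤ 1/2`. The
loss of `1/2` is harmless in an average exceeding `1`, and the weighted integral of `G` converges at
`0` as well as at `∞`. -/
lemma exists_kernel {ρ : ℝ} (hρ : 0 < ρ) (hcont : ContinuousOn Φ (Ici 0))
    (hmono : MonotoneOn Φ (Ici 0)) (h0 : Φ 0 = 0) (hB : MemB ρ Φ) :
    ∃ G : ℝ≥0∞ → ℝ≥0∞, Measurable G ∧ G 0 = 0 ∧ (∀ y, ext Φ y ≤ G y + 2⁻¹) ∧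
      ∫⁻ s in Ioi (0 : ℝ), ENNReal.ofReal (ρ / s ^ (ρ + 1)) * G (ENNReal.ofReal s) < ∞ := by
  classical
  obtain ⟨c, hc, hint⟩ := hB
  have hnn : ∀ x, 0 ≤ x → 0 ≤ Φ x := fun x hx => by
    have := hmono (mem_Ici.2 le_rfl) (mem_Ici.2 hx) hx
    rwa [h0] at this
  obtain ⟨ε, hε, hΦε⟩ : ∃ ε : ℝ, 0 < ε ∧ Φ ε ≤ 1 / 2 := by
    have h1 : Tendsto Φ (𝓝[>] 0) (𝓝 (Φ 0)) :=
      (hcont 0 (mem_Ici.2 le_rfl)).mono_left (nhdsWithin_mono _ Ioi_subset_Ici_self)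
    rw [h0] at h1
    obtain ⟨ε, h2, h3⟩ := ((h1.eventually (ge_mem_nhds (by norm_num : (0 : ℝ) < 1 / 2))).and
      self_mem_nhdsWithin).exists
    exact ⟨ε, h3, h2⟩
  have hintε : IntegrableOn (fun t : ℝ => Φ t / t ^ (ρ + 1)) (Ioi ε) volume := by
    have h1 : IntegrableOn (fun t : ℝ => Φ t / t ^ (ρ + 1)) (Icc ε c) volume := by
      refine ContinuousOn.integrableOn_Icc ?_
      refine (hcont.mono fun t ht => mem_Ici.2 (hε.le.trans ht.1)).div ?_ ?_
      · exact continuousOn_id.rpow_const fun t ht => Or.inl (hε.trans_le ht.1).ne'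
      · intro t ht
        have : 0 < t := hε.trans_le ht.1
        positivity
    refine (h1.union hint).mono_set fun t ht => ?_
    rcases le_or_gt t c with h | h
    · exact Or.inl ⟨le_of_lt ht, h⟩
    · exact Or.inr h
  refine ⟨(Ioi (ENNReal.ofReal ε)).indicator (ext Φ),
    (measurable_ext hmono).indicator measurableSet_Ioi, by simp, fun y => ?_, ?_⟩
  · by_cases hy : y ∈ Ioi (ENNReal.ofReal ε)
    · rw [indicator_of_mem hy]; exact le_self_add
    · rw [indicator_of_notMem hy, zero_add]
      refine (ext_mono hmono (not_lt.1 hy)).trans ?_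
      rw [ext_ofReal _ hε.le, show (2⁻¹ : ℝ≥0∞) = ENNReal.ofReal (1 / 2) by
        rw [one_div, ENNReal.ofReal_inv_of_pos (by norm_num)]; simp]
      exact ENNReal.ofReal_le_ofReal hΦε
  · calc _ = ∫⁻ s in Ioi (0 : ℝ), (Ioi ε).indicator
          (fun s => ENNReal.ofReal (ρ * (Φ s / s ^ (ρ + 1)))) s := by
          refine setLIntegral_congr_fun measurableSet_Ioi fun s hs => ?_
          have hs' : 0 < s := hs
          by_cases h : ε < s
          · have h' : ENNReal.ofReal s ∈ Ioi (ENNReal.ofReal ε) :=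
              (ENNReal.ofReal_lt_ofReal_iff hs').2 h
            rw [indicator_of_mem h', indicator_of_mem (mem_Ioi.2 h), ext_ofReal _ hs'.le,
              ← ENNReal.ofReal_mul (by positivity)]
            congr 1; ring
          · have h' : ENNReal.ofReal s ∉ Ioi (ENNReal.ofReal ε) := fun h'' =>
              h ((ENNReal.ofReal_lt_ofReal_iff hs').1 h'')
            rw [indicator_of_notMem h', indicator_of_notMem (by simpa using h), mul_zero]
      _ ≤ ∫⁻ s, (Ioi ε).indicator
          (fun s => ENNReal.ofReal (ρ * (Φ s / s ^ (ρ + 1)))) s := setLIntegral_le_lintegral _ _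
      _ = ∫⁻ s in Ioi ε, ENNReal.ofReal (ρ * (Φ s / s ^ (ρ + 1))) :=
          lintegral_indicator measurableSet_Ioi _
      _ < ∞ := (hintε.const_mul ρ).lintegral_lt_top

/-- The Orlicz maximal operator of a `B_ρ` function is bounded on `L^ρ`, uniformly over the finite
laminar families. -/
theorem exists_lintegral_maxOn_orliczAvg_le {ρ : ℝ} (hρ : 0 < ρ) (hcont : ContinuousOn Φ (Ici 0))
    (hmono : MonotoneOn Φ (Ici 0)) (h0 : Φ 0 = 0) (hB : MemB ρ Φ) :
    ∃ C : NNReal, ∀ 𝒢 : Finset (Set (Fin n → ℝ)), Laminar (𝒢 : Set (Set (Fin n → ℝ))) →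
      (∀ Q ∈ 𝒢, MeasurableSet Q ∧ volume Q ≠ 0 ∧ volume Q ≠ ∞) →
      ∀ F : (Fin n → ℝ) → ℝ≥0∞, AEMeasurable F volume →
        ∫⁻ x, maxOn 𝒢 (fun Q => orliczAvg Φ Q F) x ^ ρ ≤ C * ∫⁻ x, F x ^ ρ := by
  obtain ⟨G, hGm, hG0, hG, hGint⟩ := exists_kernel hρ hcont hmono h0 hB
  set C₀ := ∫⁻ s in Ioi (0 : ℝ), ENNReal.ofReal (ρ / s ^ (ρ + 1)) * G (ENNReal.ofReal s) with hC₀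
  -- Adding `1` keeps the constant nonzero, so that the pointwise bound is `∞` where `F = ∞`.
  refine ⟨2 * (C₀.toNNReal + 1), fun 𝒢 hl h𝒢 F hF => ?_⟩
  wlog hFm : Measurable F generalizing F
  · have h := this (hF.mk F) hF.measurable_mk.aemeasurable hF.measurable_mk
    have h1 : (fun Q => orliczAvg Φ Q (hF.mk F)) = fun Q => orliczAvg Φ Q F :=
      funext fun Q => orliczAvg_congr_ae hF.ae_eq_mk.symm
    have h2 : ∫⁻ x, hF.mk F x ^ ρ = ∫⁻ x, F x ^ ρ := lintegral_congr_ae <| by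
      filter_upwards [hF.ae_eq_mk] with x hx
      rw [hx]
    rwa [h1, h2] at h
  set M := maxOn 𝒢 (fun Q => orliczAvg Φ Q F) with hM
  have hMm : Measurable M := measurable_maxOn fun Q hQ => (h𝒢 Q hQ).1
  -- The stopping sets are disjoint, so the local estimates add up without a covering lemma.
  have hweak : ∀ t : ℝ, 0 < t →
      volume {x | ENNReal.ofReal t < M x} ≤ 2 * ∫⁻ x, G (F x / ENNReal.ofReal t) := by
    intro t ht
    rw [hM, setOf_lt_maxOn]
    calc _ ≤ ∑ Q ∈ maxSets 𝒢 (fun Q => orliczAvg Φ Q F) (ENNReal.ofReal t), volume Q :=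
          measure_biUnion_finset_le _ _
      _ ≤ ∑ Q ∈ maxSets 𝒢 (fun Q => orliczAvg Φ Q F) (ENNReal.ofReal t),
            2 * ∫⁻ x in Q, G (F x / ENNReal.ofReal t) := by
          refine Finset.sum_le_sum fun Q hQ => ?_
          obtain ⟨hQ𝒢, hQt, -⟩ := mem_maxSets.1 hQ
          exact volume_le_of_lt_orliczAvg hG (h𝒢 Q hQ𝒢).2.1 (h𝒢 Q hQ𝒢).2.2 ht hQt
      _ = 2 * ∫⁻ x in ⋃ Q ∈ maxSets 𝒢 (fun Q => orliczAvg Φ Q F) (ENNReal.ofReal t), Q,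
            G (F x / ENNReal.ofReal t) := by
          rw [← Finset.mul_sum]
          congr 1
          exact (lintegral_biUnion_finset (t := id) (pairwiseDisjoint_maxSets hl)
            (fun Q hQ => (h𝒢 Q (mem_maxSets.1 hQ).1).1) _).symm
      _ ≤ _ := by
          gcongr 2 * ?_
          exact setLIntegral_le_lintegral _ _
  have hpow : Measurable fun t : ℝ => ENNReal.ofReal (ρ * t ^ (ρ - 1)) := by fun_prop
  calc ∫⁻ x, M x ^ ρ ≤ ∫⁻ x, ∫⁻ t in Ioi (0 : ℝ), ENNReal.ofReal (ρ * t ^ (ρ - 1)) *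
        {t : ℝ | ENNReal.ofReal t < M x}.indicator (fun _ => 1) t :=
        lintegral_mono fun x => rpow_le_lintegral_indicator hρ _
    _ = ∫⁻ t in Ioi (0 : ℝ), ∫⁻ x, ENNReal.ofReal (ρ * t ^ (ρ - 1)) *
        {t : ℝ | ENNReal.ofReal t < M x}.indicator (fun _ => 1) t := by
        refine lintegral_lintegral_swap (Measurable.aemeasurable ?_)
        refine (hpow.comp measurable_snd).mul ?_
        exact (measurable_const (a := (1 : ℝ≥0∞))).indicator
          (s := {z : (Fin n → ℝ) × ℝ | ENNReal.ofReal z.2 < M z.1})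
          (measurableSet_lt (ENNReal.measurable_ofReal.comp measurable_snd)
            (hMm.comp measurable_fst))
    _ ≤ ∫⁻ t in Ioi (0 : ℝ), ∫⁻ x, 2 * (ENNReal.ofReal (ρ * t ^ (ρ - 1)) *
          G (F x / ENNReal.ofReal t)) := by
        refine setLIntegral_mono' measurableSet_Ioi fun t ht => ?_
        rw [lintegral_const_mul' _ _ ENNReal.ofReal_ne_top,
          lintegral_const_mul' _ _ (by simp : (2 : ℝ≥0∞) ≠ ∞),
          lintegral_const_mul' _ _ ENNReal.ofReal_ne_top, mul_left_comm]
        gcongr ENNReal.ofReal (ρ * t ^ (ρ - 1)) * ?_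
        refine le_trans (le_of_eq ?_) (hweak t ht)
        rw [← lintegral_indicator_one (measurableSet_lt measurable_const hMm)]
        rfl
    _ = ∫⁻ x, ∫⁻ t in Ioi (0 : ℝ), 2 * (ENNReal.ofReal (ρ * t ^ (ρ - 1)) *
          G (F x / ENNReal.ofReal t)) := by
        refine lintegral_lintegral_swap (Measurable.aemeasurable ?_)
        refine ((hpow.comp measurable_fst).mul (hGm.comp ?_)).const_mul 2
        exact (hFm.comp measurable_snd).div (ENNReal.measurable_ofReal.comp measurable_fst)
    _ ≤ ∫⁻ x, ((2 * (C₀.toNNReal + 1) : NNReal) : ℝ≥0∞) * F x ^ ρ := by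
        refine lintegral_mono fun x => ?_
        simp only []
        rw [lintegral_const_mul' _ _ (by simp : (2 : ℝ≥0∞) ≠ ∞), ENNReal.coe_mul, mul_assoc]
        gcongr
        · simp
        · refine lintegral_rpow_mul_comp_div_le hρ G hG0 (by simp) ?_ _
          rw [ENNReal.coe_add, ENNReal.coe_toNNReal hGint.ne]
          exact le_self_add
    _ = _ := lintegral_const_mul' _ _ ENNReal.coe_ne_top

end OrliczMaximal

/-! ### Translated dyadic grids and the one-third trick. -/

section Grid

variable {n : ℕ}

lemma mem_cube {a x : Fin n → ℝ} {l : ℝ} : x ∈ cube a l ↔ ∀ i, a i ≤ x i ∧ x i < a i + l := by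
  simp [cube]

lemma volume_cube (a : Fin n → ℝ) (l : ℝ) : volume (cube a l) = ENNReal.ofReal l ^ n := by
  rw [cube, Real.volume_pi_Ico]
  simp

lemma measurableSet_cube (a : Fin n → ℝ) (l : ℝ) : MeasurableSet (cube a l) :=
  MeasurableSet.univ_pi fun _ => measurableSet_Ico

lemma volume_cube_ne_zero (a : Fin n → ℝ) {l : ℝ} (hl : 0 < l) : volume (cube a l) ≠ 0 := by
  rw [volume_cube]
  exact pow_ne_zero _ (by simpa using hl)

lemma volume_cube_ne_top (a : Fin n → ℝ) (l : ℝ) : volume (cube a l) ≠ ∞ := by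
  rw [volume_cube]
  finiteness

/-- The cubes of the dyadic grid translated by `τ`. -/
def dcube (τ : Fin n → ℝ) (i : ℤ × (Fin n → ℤ)) : Set (Fin n → ℝ) :=
  cube (fun j => 2 ^ i.1 * i.2 j + τ j) (2 ^ i.1)

/-- In units of `2 ^ k` all endpoints are integers; the strict inequalities at a common point `y`
sharpen to the weak inequalities between endpoints. -/
lemma two_zpow_mul_nested {k k' m m' : ℤ} (hk : k ≤ k') {y : ℝ}
    (h1 : (2 : ℝ) ^ k * m ≤ y) (h2 : y < 2 ^ k * m + 2 ^ k)
    (h3 : (2 : ℝ) ^ k' * m' ≤ y) (h4 : y < 2 ^ k' * m' + 2 ^ k') :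
    (2 : ℝ) ^ k' * m' ≤ 2 ^ k * m ∧ (2 : ℝ) ^ k * m + 2 ^ k ≤ 2 ^ k' * m' + 2 ^ k' := by
  obtain ⟨j, rfl⟩ := Int.le.dest hk
  have hpos : (0 : ℝ) < 2 ^ k := by positivity
  have hJ : (2 : ℝ) ^ (k + (j : ℤ)) = 2 ^ k * ((2 ^ j : ℤ) : ℝ) := by
    rw [zpow_add₀ (by norm_num)]; simp
  rw [hJ] at h3 h4 ⊢
  have h5 : (2 ^ j : ℤ) * m' < m + 1 := by
    have : (2 : ℝ) ^ k * ((2 ^ j : ℤ) * m' : ℝ) < 2 ^ k * (m + 1) := by linarith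
    exact_mod_cast lt_of_mul_lt_mul_left this hpos.le
  have h6 : m < (2 ^ j : ℤ) * m' + 2 ^ j := by
    have : (2 : ℝ) ^ k * m < 2 ^ k * ((2 ^ j : ℤ) * m' + (2 ^ j : ℤ)) := by linarith
    exact_mod_cast lt_of_mul_lt_mul_left this hpos.le
  have h5' : ((2 ^ j : ℤ) : ℝ) * m' ≤ m := by exact_mod_cast Int.lt_add_one_iff.1 h5
  have h6' : (m : ℝ) + 1 ≤ ((2 ^ j : ℤ) : ℝ) * m' + (2 ^ j : ℤ) := by
    exact_mod_cast Int.add_one_le_iff.2 h6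
  constructor
  · calc (2 : ℝ) ^ k * ((2 ^ j : ℤ) : ℝ) * m' = 2 ^ k * (((2 ^ j : ℤ) : ℝ) * m') := by ring
      _ ≤ _ := by gcongr
  · calc (2 : ℝ) ^ k * m + 2 ^ k = 2 ^ k * (m + 1) := by ring
      _ ≤ 2 ^ k * (((2 ^ j : ℤ) : ℝ) * m' + (2 ^ j : ℤ)) := by gcongr
      _ = _ := by ring

lemma laminar_range_dcube (τ : Fin n → ℝ) : Laminar (range (dcube τ)) := by
  have key : ∀ i i' : ℤ × (Fin n → ℤ), i.1 ≤ i'.1 → (dcube τ i ∩ dcube τ i').Nonempty →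
      dcube τ i ⊆ dcube τ i' := by
    rintro i i' hi ⟨y, hy, hy'⟩ x hx
    rw [dcube, mem_cube] at *
    intro j
    have := two_zpow_mul_nested hi (y := y j - τ j) (m := i.2 j) (m' := i'.2 j)
      (by linarith [(hy j).1]) (by linarith [(hy j).2]) (by linarith [(hy' j).1])
      (by linarith [(hy' j).2])
    exact ⟨by linarith [(hx j).1], by linarith [(hx j).2]⟩
  rintro _ ⟨i, rfl⟩ _ ⟨i', rfl⟩ h
  rcases le_total i.1 i'.1 with hi | hi
  · exact Or.inl (key i i' hi h)
  · exact Or.inr (key i' i hi (by rwa [inter_comm]))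

/-- The translations used in the one-third trick for scales up to `2 ^ N`. -/
def gridShift (N : ℤ) (σ : Fin n → Bool) (j : Fin n) : ℝ := if σ j then 2 ^ N / 3 else 0

/-- If the interval fits in neither grid, both have an endpoint inside it, so these differ by less
than `2 ^ k / 3`. With `N = k + j` this forces the integer `3 (m - m') - 2 ^ j` to be `0`, although
`3` does not divide `2 ^ j`. The shift `2 ^ N / 3` is the same for all scales `k ≤ N`, so the
translates form a genuine nested grid. -/
lemma exists_interval_subset {k N : ℤ} (hk : k ≤ N) {a l : ℝ} (hl : 3 * l ≤ 2 ^ k) :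
    ∃ b : Bool, ∃ m : ℤ, 2 ^ k * (m : ℝ) + (if b then 2 ^ N / 3 else 0) ≤ a ∧
      a + l ≤ 2 ^ k * (m : ℝ) + (if b then 2 ^ N / 3 else 0) + 2 ^ k := by
  obtain ⟨j, rfl⟩ := Int.le.dest hk
  have hpos : (0 : ℝ) < 2 ^ k := by positivity
  have hJ : (2 : ℝ) ^ (k + (j : ℤ)) = 2 ^ k * ((2 ^ j : ℤ) : ℝ) := by
    rw [zpow_add₀ (by norm_num)]; simp
  have hfl : ∀ y : ℝ, 2 ^ k * (⌊y / 2 ^ k⌋ : ℝ) ≤ y ∧ y < 2 ^ k * (⌊y / 2 ^ k⌋ : ℝ) + 2 ^ k := by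
    intro y
    have h1 := Int.floor_le (y / 2 ^ k)
    have h2 := Int.lt_floor_add_one (y / 2 ^ k)
    rw [le_div_iff₀ hpos] at h1
    rw [div_lt_iff₀ hpos] at h2
    exact ⟨by linarith, by linarith⟩
  set m := ⌊a / 2 ^ k⌋ with hm
  set m' := ⌊(a - 2 ^ (k + (j : ℤ)) / 3) / 2 ^ k⌋ with hm'
  have h1 := hfl a
  have h2 := hfl (a - 2 ^ (k + (j : ℤ)) / 3)
  rw [← hm] at h1
  rw [← hm'] at h2
  by_cases h3 : a + l ≤ 2 ^ k * (m : ℝ) + 2 ^ k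
  · exact ⟨false, m, by simpa using h1.1, by simpa using h3⟩
  by_cases h4 : a + l ≤ 2 ^ k * (m' : ℝ) + 2 ^ (k + (j : ℤ)) / 3 + 2 ^ k
  · exact ⟨true, m', by simpa using (by linarith [h2.1] :
      2 ^ k * (m' : ℝ) + 2 ^ (k + (j : ℤ)) / 3 ≤ a), by simpa using h4⟩
  exfalso
  push Not at h3 h4
  rw [hJ] at h2 h4
  have h5 : (2 : ℝ) ^ k * (3 * (m - m') - (2 ^ j : ℤ)) < 2 ^ k * 1 := by linarith [h1.1, h2.2]
  have h6 : (2 : ℝ) ^ k * (-1) < 2 ^ k * (3 * (m - m') - (2 ^ j : ℤ)) := by linarith [h1.2, h2.1]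
  have h7 : 3 * (m - m') - 2 ^ j < 1 := by exact_mod_cast lt_of_mul_lt_mul_left h5 hpos.le
  have h8 : -1 < 3 * (m - m') - 2 ^ j := by exact_mod_cast lt_of_mul_lt_mul_left h6 hpos.le
  have h9 : (3 : ℤ) ∣ 2 ^ j := ⟨m - m', by lia⟩
  have h10 := Int.prime_three.dvd_of_dvd_pow h9
  norm_num at h10

/-- The one-third trick: a cube lies in a cube of comparable size from one of `2 ^ n` grids. -/
lemma exists_dcube_superset (a : Fin n → ℝ) {l : ℝ} (hl : 0 < l) :
    ∃ K : ℤ, ∀ N, K ≤ N → ∃ (σ : Fin n → Bool) (i : ℤ × (Fin n → ℤ)),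
      cube a l ⊆ dcube (gridShift N σ) i ∧
      volume (dcube (gridShift N σ) i) ≤ 6 ^ n * volume (cube a l) := by
  -- The side `2 ^ (k + 1)` satisfies `3 l ≤ 2 ^ (k + 1) < 6 l`, whence the factor `6 ^ n`.
  obtain ⟨k, hk1, hk2⟩ := exists_mem_Ioc_zpow (x := 3 * l) (by positivity) one_lt_two
  refine ⟨k + 1, fun N hN => ?_⟩
  choose σ m h1 h2 using fun j => exists_interval_subset hN (a := a j) hk2
  refine ⟨σ, (k + 1, m), fun x hx => ?_, ?_⟩
  · rw [dcube, mem_cube]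
    rw [mem_cube] at hx
    intro j
    have h1j := h1 j
    have h2j := h2 j
    simp only [gridShift]
    exact ⟨h1j.trans (hx j).1, (hx j).2.trans_le h2j⟩
  · rw [dcube, volume_cube, volume_cube, ← mul_pow]
    gcongr
    rw [show (6 : ℝ≥0∞) = ENNReal.ofReal 6 by simp, ← ENNReal.ofReal_mul (by norm_num)]
    refine ENNReal.ofReal_le_ofReal ?_
    rw [zpow_add_one₀ (by norm_num)]
    linarith

/-- The maximal function of `A` over a translated dyadic grid. -/
def dyadicMax (τ : Fin n → ℝ) (A : Set (Fin n → ℝ) → ℝ≥0∞) (x : Fin n → ℝ) : ℝ≥0∞ :=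
  ⨆ i, (dcube τ i).indicator (fun _ => A (dcube τ i)) x

lemma measurable_dyadicMax (τ : Fin n → ℝ) (A : Set (Fin n → ℝ) → ℝ≥0∞) :
    Measurable (dyadicMax τ A) :=
  Measurable.iSup fun _ => measurable_const.indicator (measurableSet_cube _ _)

/-- Uniform bounds over finite subfamilies pass to the whole grid. -/
lemma lintegral_dyadicMax_rpow_le (τ : Fin n → ℝ) (A : Set (Fin n → ℝ) → ℝ≥0∞)
    (ν : Measure (Fin n → ℝ)) {q : ℝ} (hq : 0 < q) {B : ℝ≥0∞}
    (h : ∀ 𝒢 : Finset (Set (Fin n → ℝ)), (𝒢 : Set (Set (Fin n → ℝ))) ⊆ range (dcube τ) →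
      ∫⁻ x, maxOn 𝒢 A x ^ q ∂ν ≤ B) :
    ∫⁻ x, dyadicMax τ A x ^ q ∂ν ≤ B := by
  classical
  have hsup : ∀ x, dyadicMax τ A x ^ q
      = ⨆ t : Finset (ℤ × (Fin n → ℤ)), maxOn (t.image (dcube τ)) A x ^ q := by
    intro x
    have h1 : dyadicMax τ A x = ⨆ t : Finset (ℤ × (Fin n → ℤ)), maxOn (t.image (dcube τ)) A x := by
      rw [dyadicMax, iSup_eq_iSup_finset]
      refine iSup_congr fun t => ?_
      rw [maxOn, Finset.sup_image, Finset.sup_eq_iSup]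
      rfl
    rw [h1]
    exact (ENNReal.orderIsoRpow q hq).map_iSup _
  have hmeas : ∀ t : Finset (ℤ × (Fin n → ℤ)), ∀ Q ∈ t.image (dcube τ), MeasurableSet Q := by
    intro t Q hQ
    obtain ⟨i, -, rfl⟩ := Finset.mem_image.1 hQ
    exact measurableSet_cube _ _
  simp_rw [hsup]
  rw [lintegral_iSup_directed]
  · refine iSup_le fun t => h _ ?_
    intro Q hQ
    obtain ⟨i, -, rfl⟩ := Finset.mem_image.1 (Finset.mem_coe.1 hQ)
    exact mem_range_self i
  · exact fun t => ((measurable_maxOn (hmeas t)).pow_const q).aemeasurable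
  · refine Monotone.directed_le fun t t' htt' x => ?_
    refine ENNReal.rpow_le_rpow ?_ hq.le
    exact Finset.sup_mono (Finset.image_subset_image htt')

end Grid

/-! ### From dyadic grids to all cubes. -/

section Reduction

variable {n : ℕ}

/-- The functional whose supremum over cubes is the bilinear maximal function. -/
def bilinAvg (α r s : ℝ) (f g : (Fin n → ℝ) → ℂ) (Q : Set (Fin n → ℝ)) : ℝ≥0∞ :=
  volume Q ^ (α / n) * (⨍⁻ y in Q, ‖f y‖ₑ ^ r ∂volume) ^ (1 / r)
    * (⨍⁻ y in Q, ‖g y‖ₑ ^ s ∂volume) ^ (1 / s)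

variable {α r s : ℝ} {f g : (Fin n → ℝ) → ℂ}

lemma setLAverage_le_mul_of_subset {Q Q' : Set (Fin n → ℝ)} (h : Q ⊆ Q') {κ : ℝ≥0∞}
    (hQ0 : volume Q ≠ 0) (hQ' : volume Q' ≠ ∞) (hv : volume Q' ≤ κ * volume Q)
    (F : (Fin n → ℝ) → ℝ≥0∞) :
    ⨍⁻ x in Q, F x ∂volume ≤ κ * ⨍⁻ x in Q', F x ∂volume := by
  have hQ : volume Q ≠ ∞ := ne_top_of_le_ne_top hQ' (measure_mono h)
  have hQ'0 : volume Q' ≠ 0 := fun h0 => hQ0 (measure_mono_null h h0)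
  rw [setLAverage_eq, setLAverage_eq, ENNReal.div_le_iff hQ0 hQ, mul_right_comm]
  calc ∫⁻ x in Q, F x ≤ ∫⁻ x in Q', F x := lintegral_mono_set h
    _ = volume Q' * ((∫⁻ x in Q', F x) / volume Q') := (ENNReal.mul_div_cancel hQ'0 hQ').symm
    _ ≤ _ := by gcongr

/-- Only the two averages cost a constant; the factor with exponent `α / n ≥ 0` increases with the
cube. -/
lemma bilinAvg_le_mul_of_subset (hα : 0 ≤ α) (hr : 0 < r) (hs : 0 < s) {Q Q' : Set (Fin n → ℝ)}
    (h : Q ⊆ Q') {κ : ℝ≥0∞}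
    (hQ0 : volume Q ≠ 0) (hQ' : volume Q' ≠ ∞) (hv : volume Q' ≤ κ * volume Q) :
    bilinAvg α r s f g Q ≤ κ ^ (1 / r) * κ ^ (1 / s) * bilinAvg α r s f g Q' := by
  have hr' : 0 ≤ 1 / r := by positivity
  have hs' : 0 ≤ 1 / s := by positivity
  calc bilinAvg α r s f g Q ≤ volume Q' ^ (α / n)
        * (κ * ⨍⁻ y in Q', ‖f y‖ₑ ^ r ∂volume) ^ (1 / r)
        * (κ * ⨍⁻ y in Q', ‖g y‖ₑ ^ s ∂volume) ^ (1 / s) := by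
        rw [bilinAvg]
        gcongr
        · exact setLAverage_le_mul_of_subset h hQ0 hQ' hv _
        · exact setLAverage_le_mul_of_subset h hQ0 hQ' hv _
    _ = _ := by
        rw [bilinAvg, ENNReal.mul_rpow_of_nonneg _ _ hr', ENNReal.mul_rpow_of_nonneg _ _ hs']
        ring

/-- Bounds for the dyadic maximal functions, uniform in the translation of the grid, give bounds
for the full maximal function. -/
theorem lintegral_maximalFn_rpow_le (hα : 0 ≤ α) (hr : 0 < r) (hs : 0 < s)
    (ν : Measure (Fin n → ℝ)) {q : ℝ} (hq : 0 < q) {B : ℝ≥0∞}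
    (h : ∀ τ, ∫⁻ x, dyadicMax τ (bilinAvg α r s f g) x ^ q ∂ν ≤ B) :
    ∫⁻ x, maximalFn α r s f g x ^ q ∂ν ≤
      2 ^ n * (((6 : ℝ≥0∞) ^ n) ^ (1 / r) * (6 ^ n) ^ (1 / s)) ^ q * B := by
  set κ : ℝ≥0∞ := ((6 : ℝ≥0∞) ^ n) ^ (1 / r) * (6 ^ n) ^ (1 / s)
  have hκtop : κ ^ q ≠ ∞ := by
    refine ENNReal.rpow_ne_top_of_nonneg hq.le (ENNReal.mul_ne_top ?_ ?_) <;>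
    exact ENNReal.rpow_ne_top_of_nonneg (by positivity) (by finiteness)
  set S : ℕ → (Fin n → ℝ) → ℝ≥0∞ := fun N x =>
    ∑ σ : Fin n → Bool, κ ^ q * dyadicMax (gridShift N σ) (bilinAvg α r s f g) x ^ q with hS
  have hSm : ∀ N, Measurable (S N) := fun N => by
    refine Finset.measurable_sum _ fun σ _ => ?_
    exact ((measurable_dyadicMax _ _).pow_const q).const_mul _
  -- A grid shift serves only scales up to `2 ^ N`. Each cube is captured for all large `N`, with a
  -- threshold depending on the cube, hence the `liminf` and Fatou's lemma.
  have hpt : ∀ x, maximalFn α r s f g x ^ q ≤ liminf (fun N => S N x) atTop := by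
    intro x
    rw [← ENNReal.le_rpow_inv_iff hq, maximalFn]
    refine iSup_le fun a => iSup_le fun l => iSup_le fun hl => iSup_le fun hx => ?_
    rw [ENNReal.le_rpow_inv_iff hq]
    refine le_liminf_of_le (by isBoundedDefault) ?_
    obtain ⟨K, hK⟩ := exists_dcube_superset a hl
    have hev : ∀ᶠ N : ℕ in atTop, K ≤ (N : ℤ) :=
      (tendsto_natCast_atTop_atTop (R := ℤ)).eventually_ge_atTop K
    filter_upwards [hev] with N hN
    obtain ⟨σ, i, hsub, hvol⟩ := hK N hN
    have h1 : bilinAvg α r s f g (cube a l) ≤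
        κ * bilinAvg α r s f g (dcube (gridShift N σ) i) :=
      bilinAvg_le_mul_of_subset hα hr hs hsub (volume_cube_ne_zero a hl)
        (volume_cube_ne_top _ _) hvol
    have h2 : bilinAvg α r s f g (dcube (gridShift N σ) i) ≤
        dyadicMax (gridShift N σ) (bilinAvg α r s f g) x := by
      refine le_iSup_of_le i ?_
      rw [indicator_of_mem (hsub hx)]
    calc bilinAvg α r s f g (cube a l) ^ q
        ≤ (κ * dyadicMax (gridShift N σ) (bilinAvg α r s f g) x) ^ q := by
          refine ENNReal.rpow_le_rpow (h1.trans ?_) hq.le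
          gcongr
      _ = κ ^ q * dyadicMax (gridShift N σ) (bilinAvg α r s f g) x ^ q :=
          ENNReal.mul_rpow_of_nonneg _ _ hq.le
      _ ≤ S N x := Finset.single_le_sum (f := fun σ : Fin n → Bool =>
          κ ^ q * dyadicMax (gridShift N σ) (bilinAvg α r s f g) x ^ q)
          (fun _ _ => zero_le) (Finset.mem_univ σ)
  calc ∫⁻ x, maximalFn α r s f g x ^ q ∂ν ≤ ∫⁻ x, liminf (fun N => S N x) atTop ∂ν :=
        lintegral_mono hpt
    _ ≤ liminf (fun N => ∫⁻ x, S N x ∂ν) atTop := lintegral_liminf_le hSm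
    _ ≤ 2 ^ n * κ ^ q * B := by
        refine liminf_le_of_le (by isBoundedDefault) fun b hb => ?_
        obtain ⟨N, hN⟩ := hb.exists
        refine hN.trans ?_
        rw [hS, lintegral_finsetSum _ fun σ _ =>
          ((measurable_dyadicMax _ _).pow_const q).const_mul _]
        calc _ ≤ ∑ _σ : Fin n → Bool, κ ^ q * B := by
              refine Finset.sum_le_sum fun σ _ => ?_
              rw [lintegral_const_mul' _ _ hκtop]
              gcongr
              exact h _
          _ = _ := by simp [mul_assoc]

end Reduction

/-! ### Packing of the bilinear averages. -/

variable {n : ℕ} {α r s : ℝ} {f g : (Fin n → ℝ) → ℂ}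

lemma sum_rpow_mul_rpow_le {ι : Type*} (S : Finset ι) (I J : ι → ℝ≥0∞) {a b : ℝ} (ha : 0 < a)
    (hb : 0 < b) (hab : a + b = 1) :
    ∑ i ∈ S, I i ^ a * J i ^ b ≤ (∑ i ∈ S, I i) ^ a * (∑ i ∈ S, J i) ^ b := by
  have h := ENNReal.inner_le_Lp_mul_Lq S (fun i => I i ^ a) (fun i => J i ^ b)
    (Real.HolderConjugate.inv_inv ha hb hab)
  simpa only [← ENNReal.rpow_mul, mul_inv_cancel₀ ha.ne', mul_inv_cancel₀ hb.ne',
    ENNReal.rpow_one, one_div, inv_inv] using h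

lemma lintegral_rpow_mul_rpow_le {X : Type*} [MeasurableSpace X] {μ : Measure X}
    {F G : X → ℝ≥0∞} (hF : Measurable F) (hG : Measurable G) {a b : ℝ} (ha : 0 < a)
    (hb : 0 < b) (hab : a + b = 1) :
    ∫⁻ x, F x ^ a * G x ^ b ∂μ ≤ (∫⁻ x, F x ∂μ) ^ a * (∫⁻ x, G x ∂μ) ^ b := by
  have h := ENNReal.lintegral_mul_le_Lp_mul_Lq μ (Real.HolderConjugate.inv_inv ha hb hab)
    (hF.pow_const a).aemeasurable (hG.pow_const b).aemeasurable
  simpa only [Pi.mul_apply, ← ENNReal.rpow_mul, mul_inv_cancel₀ ha.ne', mul_inv_cancel₀ hb.ne',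
    ENNReal.rpow_one, one_div, inv_inv] using h

/-- The exponent `t` is chosen so that the normalising powers of `volume Q` from the two averages
cancel the factor `volume Q`. -/
lemma bilinAvg_rpow_mul_volume {t : ℝ} (ht : 0 < t) (hr : 0 < r) (hs : 0 < s)
    (htrs : t / r + t / s = 1)
    {Q : Set (Fin n → ℝ)} (hQ0 : volume Q ≠ 0) (hQ : volume Q ≠ ∞) :
    bilinAvg α r s f g Q ^ t * volume Q = volume Q ^ (α / n * t) *
      ((∫⁻ y in Q, ‖f y‖ₑ ^ r) ^ (t / r) * (∫⁻ y in Q, ‖g y‖ₑ ^ s) ^ (t / s)) := by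
  have h1 : 1 / r * t = t / r := by ring
  have h2 : 1 / s * t = t / s := by ring
  have h3 : volume Q ^ (-(t / r)) * volume Q ^ (-(t / s)) * volume Q = 1 := by
    nth_rewrite 3 [← ENNReal.rpow_one (volume Q)]
    rw [← ENNReal.rpow_add _ _ hQ0 hQ, ← ENNReal.rpow_add _ _ hQ0 hQ,
      show -(t / r) + -(t / s) + 1 = 0 by linarith, ENNReal.rpow_zero]
  rw [bilinAvg, setLAverage_eq, setLAverage_eq, ENNReal.mul_rpow_of_nonneg _ _ ht.le,
    ENNReal.mul_rpow_of_nonneg _ _ ht.le, ← ENNReal.rpow_mul, ← ENNReal.rpow_mul,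
    ← ENNReal.rpow_mul, h1, h2, ENNReal.div_rpow_of_nonneg _ _ (by positivity),
    ENNReal.div_rpow_of_nonneg _ _ (by positivity), ENNReal.div_eq_inv_mul,
    ENNReal.div_eq_inv_mul, ← ENNReal.rpow_neg, ← ENNReal.rpow_neg]
  calc _ = volume Q ^ (α / n * t) *
      ((∫⁻ y in Q, ‖f y‖ₑ ^ r) ^ (t / r) * (∫⁻ y in Q, ‖g y‖ₑ ^ s) ^ (t / s)) *
      (volume Q ^ (-(t / r)) * volume Q ^ (-(t / s)) * volume Q) := by ring
    _ = _ := by rw [h3, mul_one]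

/-- The packing condition for the bilinear averages. -/
lemma sum_bilinAvg_rpow_mul_volume_le (hα : 0 ≤ α) {t : ℝ} (ht : 0 < t) (hr : 0 < r) (hs : 0 < s)
    (htrs : t / r + t / s = 1) {Q : Set (Fin n → ℝ)} (hQ0 : volume Q ≠ 0) (hQ : volume Q ≠ ∞)
    {𝒮 : Finset (Set (Fin n → ℝ))} (hm : ∀ P ∈ 𝒮, MeasurableSet P ∧ volume P ≠ 0)
    (hd : (𝒮 : Set (Set (Fin n → ℝ))).PairwiseDisjoint id) (hsub : ∀ P ∈ 𝒮, P ⊆ Q) :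
    ∑ P ∈ 𝒮, bilinAvg α r s f g P ^ t * volume P ≤ bilinAvg α r s f g Q ^ t * volume Q := by
  have hint : ∀ F : (Fin n → ℝ) → ℝ≥0∞, ∑ P ∈ 𝒮, ∫⁻ y in P, F y ≤ ∫⁻ y in Q, F y := by
    intro F
    refine (lintegral_biUnion_finset (t := id) hd (fun P hP => (hm P hP).1) F).symm.le.trans ?_
    exact lintegral_mono_set (iUnion₂_subset hsub)
  rw [bilinAvg_rpow_mul_volume ht hr hs htrs hQ0 hQ]
  calc ∑ P ∈ 𝒮, bilinAvg α r s f g P ^ t * volume P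
      ≤ ∑ P ∈ 𝒮, volume Q ^ (α / n * t) *
        ((∫⁻ y in P, ‖f y‖ₑ ^ r) ^ (t / r) * (∫⁻ y in P, ‖g y‖ₑ ^ s) ^ (t / s)) := by
        refine Finset.sum_le_sum fun P hP => ?_
        have hPQ := measure_mono (μ := volume) (hsub P hP)
        rw [bilinAvg_rpow_mul_volume ht hr hs htrs (hm P hP).2 (ne_top_of_le_ne_top hQ hPQ)]
        gcongr
    _ ≤ volume Q ^ (α / n * t) * ((∑ P ∈ 𝒮, ∫⁻ y in P, ‖f y‖ₑ ^ r) ^ (t / r) *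
          (∑ P ∈ 𝒮, ∫⁻ y in P, ‖g y‖ₑ ^ s) ^ (t / s)) := by
        rw [← Finset.mul_sum]
        gcongr
        exact sum_rpow_mul_rpow_le _ _ _ (by positivity) (by positivity) htrs
    _ ≤ _ := by
        gcongr
        · exact hint _
        · exact hint _

/-! ### Weighted Hölder inequality and exponent bookkeeping. -/

section Testing

variable {Φ Ψ : ℝ → ℝ} {v : (Fin n → ℝ) → ℝ≥0∞} {Q : Set (Fin n → ℝ)}

/-- Hölder's inequality with a weight, on a cube where the bump of the weight is finite. -/
lemma setLAverage_rpow_le_orliczAvg_mul (hΦ : IsYoung Φ) (h : IsAssociate Φ Ψ) {p : ℝ}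
    (hr : 0 < r) (hp : 0 < p) (hQ0 : volume Q ≠ 0) (hQ : volume Q ≠ ∞)
    (hf : AEStronglyMeasurable f volume) (hv : AEMeasurable v volume)
    (hfin : ∫⁻ x, ‖f x‖ₑ ^ p * v x ≠ ∞)
    (hW : orliczAvg Φ Q (fun x => v x ^ (-(r / p))) ≠ ∞) :
    ⨍⁻ x in Q, ‖f x‖ₑ ^ r ∂volume ≤ 4 * (orliczAvg Ψ Q (fun x => ‖f x‖ₑ ^ r * v x ^ (r / p))
      * orliczAvg Φ Q (fun x => v x ^ (-(r / p)))) := by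
  have hmono := hΦ.strictMonoOn.monotoneOn
  have hrp : 0 < r / p := by positivity
  have hWm : AEMeasurable (fun x => v x ^ (-(r / p))) volume := hv.pow_const _
  have hFm : AEMeasurable (fun x => ‖f x‖ₑ ^ r * v x ^ (r / p)) volume :=
    (hf.enorm.pow_const _).mul (hv.pow_const _)
  have hΦ1 : 0 < Φ 1 := by
    have := hΦ.strictMonoOn (mem_Ici.2 le_rfl) (mem_Ici.2 zero_le_one) one_pos
    rwa [hΦ.map_zero] at this
  obtain ⟨C, hC⟩ := exists_le_mul_one_add hΦ.convexOn hΦ.map_zero (fun x hx => hΦ.nonneg hx)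
    ⟨1, one_pos, hΦ1⟩
  have h1 := setLAverage_rpow_le (F := fun x => v x ^ (-(r / p))) one_pos hmono hΦ.map_zero
    (C := C) (by simpa using hC) hQ0 hQ
  simp only [ENNReal.rpow_one] at h1
  have h2 : ∫⁻ x in Q, v x ^ (-(r / p)) ≠ ∞ := by
    intro htop
    rw [setLAverage_eq, htop, ENNReal.top_div_of_ne_top hQ] at h1
    exact (ENNReal.mul_ne_top ENNReal.coe_ne_top hW) (top_le_iff.1 h1)
  have h3 := ae_lt_top' hWm.restrict h2
  have h4 : ∀ᵐ x ∂volume.restrict Q, ‖f x‖ₑ ^ p * v x < ∞ :=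
    ae_restrict_of_ae (ae_lt_top' ((hf.enorm.pow_const _).mul hv) hfin)
  -- The factorisation `1 = v^(r/p) v^(-(r/p))` fails only where `v` is `0` or `∞`. The finite bump
  -- makes the first set null in `Q`; on the second, `f` vanishes almost everywhere because its
  -- weighted norm is finite.
  have h5 : ∫⁻ x in Q, ‖f x‖ₑ ^ r =
      ∫⁻ x in Q, (‖f x‖ₑ ^ r * v x ^ (r / p)) * v x ^ (-(r / p)) := by
    refine lintegral_congr_ae ?_
    filter_upwards [h3, h4] with x hx3 hx4
    have hv0 : v x ≠ 0 := by
      intro h0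
      rw [h0, ENNReal.zero_rpow_of_neg (by linarith)] at hx3
      exact lt_irrefl _ hx3
    rcases eq_or_ne (v x) ∞ with htop | htop
    · have hf0 : ‖f x‖ₑ = 0 := by
        by_contra hne
        rw [htop, ENNReal.mul_top] at hx4
        · exact lt_irrefl _ hx4
        · simpa [hp] using hne
      simp [hf0, hr]
    · rw [mul_assoc, ← ENNReal.rpow_add _ _ hv0 htop, add_neg_cancel, ENNReal.rpow_zero, mul_one]
  calc ⨍⁻ x in Q, ‖f x‖ₑ ^ r ∂volume
      = ⨍⁻ x in Q, (‖f x‖ₑ ^ r * v x ^ (r / p)) * v x ^ (-(r / p)) ∂volume := by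
        rw [setLAverage_eq, setLAverage_eq, h5]
    _ ≤ _ := h.setLAverage_mul_le hΦ hQ0 hQ hFm hWm

/-- Writing `V^β V^(1/q) = V^(β + 1/q - 1/p) V^(1/p)` isolates the quantity in the bump condition.
-/
lemma testing_rearrange {V X Y U V₁ V₂ K : ℝ≥0∞} {p q : ℝ} (hV0 : V ≠ 0) (hV : V ≠ ∞)
    (hp : 0 < p) (hq : 0 < q) (hr : 0 < r) (hs : 0 < s) (β : ℝ) :
    (V ^ β * (4 * (X * V₁)) ^ (1 / r) * (4 * (Y * V₂)) ^ (1 / s)) ^ q * (V * (K * U ^ q)) =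
      (4 ^ (1 / r) * 4 ^ (1 / s)) ^ q * K *
        (V ^ (β + 1 / q - 1 / p) * U * V₁ ^ (1 / r) * V₂ ^ (1 / s)) ^ q *
        (V * (X ^ (1 / r) * Y ^ (1 / s)) ^ p) ^ (q / p) := by
  have hr' : 0 ≤ 1 / r := by positivity
  have hs' : 0 ≤ 1 / s := by positivity
  have h1 : V = (V ^ (1 / q)) ^ q := by
    rw [← ENNReal.rpow_mul, one_div, inv_mul_cancel₀ hq.ne', ENNReal.rpow_one]
  have h2 : V ^ β * V ^ (1 / q) = V ^ (β + 1 / q - 1 / p) * V ^ (1 / p) := by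
    rw [← ENNReal.rpow_add _ _ hV0 hV, ← ENNReal.rpow_add _ _ hV0 hV, sub_add_cancel]
  have h3 : (V * (X ^ (1 / r) * Y ^ (1 / s)) ^ p) ^ (q / p) =
      (V ^ (1 / p) * (X ^ (1 / r) * Y ^ (1 / s))) ^ q := by
    rw [ENNReal.mul_rpow_of_nonneg V _ (by positivity), ← ENNReal.rpow_mul _ p (q / p),
      mul_div_cancel₀ _ hp.ne', ENNReal.mul_rpow_of_nonneg (V ^ (1 / p)) _ hq.le,
      ← ENNReal.rpow_mul V (1 / p) q]
    congr 2
    ring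
  rw [h3]
  calc _ = K * ((V ^ β * (4 * (X * V₁)) ^ (1 / r) * (4 * (Y * V₂)) ^ (1 / s)) * V ^ (1 / q) * U) ^ q
        := by
        rw [ENNReal.mul_rpow_of_nonneg _ U hq.le, ENNReal.mul_rpow_of_nonneg _ (V ^ (1 / q)) hq.le,
          ← h1]
        ring
    _ = K * ((4 ^ (1 / r) * 4 ^ (1 / s)) *
        ((V ^ (β + 1 / q - 1 / p) * U * V₁ ^ (1 / r) * V₂ ^ (1 / s)) *
          (V ^ (1 / p) * (X ^ (1 / r) * Y ^ (1 / s))))) ^ q := by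
        congr 2
        rw [ENNReal.mul_rpow_of_nonneg _ _ hr', ENNReal.mul_rpow_of_nonneg _ _ hr',
          ENNReal.mul_rpow_of_nonneg _ _ hs', ENNReal.mul_rpow_of_nonneg _ _ hs']
        calc _ = (V ^ β * V ^ (1 / q)) * (4 ^ (1 / r) * (X ^ (1 / r) * V₁ ^ (1 / r)) *
              (4 ^ (1 / s) * (Y ^ (1 / s) * V₂ ^ (1 / s))) * U) := by ring
          _ = _ := by rw [h2]; ring
    _ = _ := by
        rw [ENNReal.mul_rpow_of_nonneg _ _ hq.le,
          ENNReal.mul_rpow_of_nonneg (V ^ (β + 1 / q - 1 / p) * U * V₁ ^ (1 / r) * V₂ ^ (1 / s)) _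
            hq.le]
        ring

end Testing

/-! ### The testing inequality, the dyadic bound and the theorem. -/

section Main

variable {p q p₁ p₂ : ℝ} {ψ φ₁ φ₂ ψ' φ₁' φ₂' : ℝ → ℝ} {u v₁ v₂ : (Fin n → ℝ) → ℝ≥0∞}

/-- The testing inequality on cubes given by the bump condition. -/
lemma bilinAvg_rpow_mul_withDensity_le (hr : 0 < r) (hs : 0 < s) (hp : 0 < p) (hq : 0 < q)
    (hp₁ : 0 < p₁) (hp₂ : 0 < p₂)
    (hψ : IsYoung ψ) (hφ₁ : IsYoung φ₁) (hφ₂ : IsYoung φ₂)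
    (hφφ₁' : IsAssociate φ₁ φ₁') (hφφ₂' : IsAssociate φ₂ φ₂')
    {Cψ : NNReal} (hCψ : ∀ a : ℝ, 0 ≤ a → a ^ q ≤ Cψ * (1 + ψ a))
    (hv₁ : AEMeasurable v₁ volume) (hv₂ : AEMeasurable v₂ volume)
    (hbump : bumpConst α p q p₁ p₂ r s ψ φ₁ φ₂ u v₁ v₂ < ∞)
    (hf : AEStronglyMeasurable f volume) (hg : AEStronglyMeasurable g volume)
    (hfin : ∫⁻ x, ‖f x‖ₑ ^ p₁ * v₁ x ≠ ∞) (hgin : ∫⁻ x, ‖g x‖ₑ ^ p₂ * v₂ x ≠ ∞)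
    (a : Fin n → ℝ) {l : ℝ} (hl : 0 < l) :
    bilinAvg α r s f g (cube a l) ^ q * volume.withDensity u (cube a l) ≤
      (4 ^ (1 / r) * 4 ^ (1 / s)) ^ q * ((2 * (Cψ + 1) : NNReal) : ℝ≥0∞) *
        bumpConst α p q p₁ p₂ r s ψ φ₁ φ₂ u v₁ v₂ ^ q *
        (volume (cube a l) *
          (orliczAvg φ₁' (cube a l) (fun x => ‖f x‖ₑ ^ r * v₁ x ^ (r / p₁)) ^ (1 / r) *
            orliczAvg φ₂' (cube a l) (fun x => ‖g x‖ₑ ^ s * v₂ x ^ (s / p₂)) ^ (1 / s)) ^ p)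
          ^ (q / p) := by
  set Q := cube a l with hQdef
  have hQ0 : volume Q ≠ 0 := volume_cube_ne_zero a hl
  have hQ : volume Q ≠ ∞ := volume_cube_ne_top a l
  set U := orliczAvg ψ Q (fun x => u x ^ (1 / q))
  set W₁ := orliczAvg φ₁ Q (fun x => v₁ x ^ (-(r / p₁))) with hW₁
  set W₂ := orliczAvg φ₂ Q (fun x => v₂ x ^ (-(s / p₂))) with hW₂
  set X := orliczAvg φ₁' Q (fun x => ‖f x‖ₑ ^ r * v₁ x ^ (r / p₁))
  set Y := orliczAvg φ₂' Q (fun x => ‖g x‖ₑ ^ s * v₂ x ^ (s / p₂))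
  have hr' : 0 < 1 / r := by positivity
  have hs' : 0 < 1 / s := by positivity
  have hB : volume Q ^ (α / n + 1 / q - 1 / p) * U * W₁ ^ (1 / r) * W₂ ^ (1 / s) ≤
      bumpConst α p q p₁ p₂ r s ψ φ₁ φ₂ u v₁ v₂ :=
    le_iSup_of_le a (le_iSup_of_le l (le_iSup_of_le hl le_rfl))
  have hν : volume.withDensity u Q ≤
      volume Q * (((2 * (Cψ + 1) : NNReal) : ℝ≥0∞) * U ^ q) := by
    have h1 := setLAverage_rpow_le (F := fun x => u x ^ (1 / q)) hq hψ.strictMonoOn.monotoneOn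
      hψ.map_zero hCψ hQ0 hQ
    have h0 : ∀ x, (u x ^ (1 / q)) ^ q = u x := fun x => by
      rw [← ENNReal.rpow_mul, one_div, inv_mul_cancel₀ hq.ne', ENNReal.rpow_one]
    simp only [h0] at h1
    rw [setLAverage_eq, ENNReal.div_le_iff hQ0 hQ] at h1
    rw [withDensity_apply _ (measurableSet_cube a l), mul_comm]
    exact h1
  have hVγ : volume Q ^ (α / n + 1 / q - 1 / p) ≠ 0 := (ENNReal.rpow_pos
    (pos_iff_ne_zero.2 hQ0) hQ).ne'
  have hf1 : W₁ ≠ ∞ → ⨍⁻ x in Q, ‖f x‖ₑ ^ r ∂volume ≤ 4 * (X * W₁) := fun h =>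
    setLAverage_rpow_le_orliczAvg_mul hφ₁ hφφ₁' hr hp₁ hQ0 hQ hf hv₁ hfin h
  have hg1 : W₂ ≠ ∞ → ⨍⁻ x in Q, ‖g x‖ₑ ^ s ∂volume ≤ 4 * (Y * W₂) := fun h =>
    setLAverage_rpow_le_orliczAvg_mul hφ₂ hφφ₂' hs hp₂ hQ0 hQ hg hv₂ hgin h
  -- Since `0 * ∞ = 0`, a finite bump product does not bound each factor. When some factor vanishes
  -- the left side is `0`; otherwise `W₁` and `W₂` must be finite.
  by_cases hU : U = 0
  · rw [hU, ENNReal.zero_rpow_of_pos hq, mul_zero, mul_zero, nonpos_iff_eq_zero] at hν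
    rw [hν, mul_zero]
    exact zero_le
  by_cases h1 : W₁ = 0
  · have : bilinAvg α r s f g Q = 0 := by
      have h0 := hf1 (by simp [h1])
      rw [h1, mul_zero, mul_zero, nonpos_iff_eq_zero] at h0
      rw [bilinAvg, h0, ENNReal.zero_rpow_of_pos hr', mul_zero, zero_mul]
    rw [this, ENNReal.zero_rpow_of_pos hq, zero_mul]
    exact zero_le
  by_cases h2 : W₂ = 0
  · have : bilinAvg α r s f g Q = 0 := by
      have h0 := hg1 (by simp [h2])
      rw [h2, mul_zero, mul_zero, nonpos_iff_eq_zero] at h0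
      rw [bilinAvg, h0, ENNReal.zero_rpow_of_pos hs', mul_zero]
    rw [this, ENNReal.zero_rpow_of_pos hq, zero_mul]
    exact zero_le
  have hW₁0 : W₁ ^ (1 / r) ≠ 0 := by simpa [hr, hr.le] using h1
  have hW₂0 : W₂ ^ (1 / s) ≠ 0 := by simpa [hs, hs.le] using h2
  have h1top : W₁ ≠ ∞ := by
    intro htop
    rw [htop, ENNReal.top_rpow_of_pos hr', ENNReal.mul_top (mul_ne_zero hVγ hU),
      ENNReal.top_mul hW₂0] at hB
    exact hbump.ne (top_le_iff.1 hB)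
  have h2top : W₂ ≠ ∞ := by
    intro htop
    rw [htop, ENNReal.top_rpow_of_pos hs',
      ENNReal.mul_top (mul_ne_zero (mul_ne_zero hVγ hU) hW₁0)] at hB
    exact hbump.ne (top_le_iff.1 hB)
  calc bilinAvg α r s f g Q ^ q * volume.withDensity u Q
      ≤ (volume Q ^ (α / n) * (4 * (X * W₁)) ^ (1 / r) * (4 * (Y * W₂)) ^ (1 / s)) ^ q *
        (volume Q * (((2 * (Cψ + 1) : NNReal) : ℝ≥0∞) * U ^ q)) := by
        rw [bilinAvg]
        gcongr
        · exact hf1 h1top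
        · exact hg1 h2top
    _ = _ := testing_rearrange (p := p) hQ0 hQ hp hq hr hs (α / n)
    _ ≤ _ := by gcongr

/-- The bound over finite families of dyadic cubes. -/
theorem exists_lintegral_maxOn_bilinAvg_le (hα : 0 ≤ α) (hr : 1 < r) (hs : 1 < s) (hrp : r < p₁)
    (hsp : s < p₂) (hp : p = p₁ * p₂ / (p₁ + p₂)) (hpq : p ≤ q) (hp1 : 1 < p)
    (hψ : IsYoung ψ) (hφ₁ : IsYoung φ₁) (hφ₂ : IsYoung φ₂) (hψψ' : IsAssociate ψ ψ')
    (hφφ₁' : IsAssociate φ₁ φ₁') (hφφ₂' : IsAssociate φ₂ φ₂')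
    (hψB : MemB (q / (q - 1)) ψ') (hφB₁ : MemB (p₁ / r) φ₁') (hφB₂ : MemB (p₂ / s) φ₂')
    (hv₁ : AEMeasurable v₁ volume) (hv₂ : AEMeasurable v₂ volume)
    (hbump : bumpConst α p q p₁ p₂ r s ψ φ₁ φ₂ u v₁ v₂ < ∞) :
    ∃ C : ℝ≥0∞, C ≠ ∞ ∧ ∀ f g : (Fin n → ℝ) → ℂ,
      AEStronglyMeasurable f volume → AEStronglyMeasurable g volume →
      ∫⁻ x, ‖f x‖ₑ ^ p₁ * v₁ x ≠ ∞ → ∫⁻ x, ‖g x‖ₑ ^ p₂ * v₂ x ≠ ∞ →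
      ∀ τ : Fin n → ℝ, ∀ 𝒢 : Finset (Set (Fin n → ℝ)),
        (𝒢 : Set (Set (Fin n → ℝ))) ⊆ range (dcube τ) →
        ∫⁻ x, maxOn 𝒢 (bilinAvg α r s f g) x ^ q ∂(volume.withDensity u) ≤
          C * ((∫⁻ x, ‖f x‖ₑ ^ p₁ * v₁ x) ^ (q / p₁) * (∫⁻ x, ‖g x‖ₑ ^ p₂ * v₂ x) ^ (q / p₂)) := by
  have hr0 : 0 < r := by linarith
  have hs0 : 0 < s := by linarith
  have hp₁ : 0 < p₁ := by linarith
  have hp₂ : 0 < p₂ := by linarith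
  have hp0 : 0 < p := by linarith
  have hq1 : 1 < q := by linarith
  have hq : 0 < q := by linarith
  have hpp : p / p₁ + p / p₂ = 1 := by rw [hp]; field_simp; ring
  obtain ⟨Cψ, hCψ⟩ := hψψ'.exists_rpow_le hψ hq1 hψB
  obtain ⟨C₁, hC₁⟩ := exists_lintegral_maxOn_orliczAvg_le (n := n) (by positivity : 0 < p₁ / r)
    hφφ₁'.continuousOn hφφ₁'.monotoneOn hφφ₁'.map_zero hφB₁
  obtain ⟨C₂, hC₂⟩ := exists_lintegral_maxOn_orliczAvg_le (n := n) (by positivity : 0 < p₂ / s)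
    hφφ₂'.continuousOn hφφ₂'.monotoneOn hφφ₂'.map_zero hφB₂
  set B := bumpConst α p q p₁ p₂ r s ψ φ₁ φ₂ u v₁ v₂
  set K : ℝ≥0∞ := (4 ^ (1 / r) * 4 ^ (1 / s)) ^ q * ((2 * (Cψ + 1) : NNReal) : ℝ≥0∞) * B ^ q
    with hK
  have hKtop : K ≠ ∞ := by
    refine ENNReal.mul_ne_top (ENNReal.mul_ne_top ?_ ENNReal.coe_ne_top)
      (ENNReal.rpow_ne_top_of_nonneg hq.le hbump.ne)
    refine ENNReal.rpow_ne_top_of_nonneg hq.le (ENNReal.mul_ne_top ?_ ?_) <;>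
    exact ENNReal.rpow_ne_top_of_nonneg (by positivity) (by simp)
  -- Packing holds for the `t`-th powers of the averages, so the embedding is run on these, with
  -- exponent `e = q / t` in place of `q`.
  set t : ℝ := r * s / (r + s) with ht
  have ht0 : 0 < t := by positivity
  have htrs : t / r + t / s = 1 := by rw [ht]; field_simp; ring
  set D : ℝ≥0∞ := (C₁ : ℝ≥0∞) ^ (q / p₁) * (C₂ : ℝ≥0∞) ^ (q / p₂) with hD
  have hDtop : D ≠ ∞ := by
    refine ENNReal.mul_ne_top ?_ ?_ <;>
    exact ENNReal.rpow_ne_top_of_nonneg (by positivity) ENNReal.coe_ne_top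
  refine ⟨2 ^ (q / t) * K * (4 * D), ENNReal.mul_ne_top (ENNReal.mul_ne_top
    (ENNReal.rpow_ne_top_of_nonneg (by positivity) (by simp)) hKtop)
    (ENNReal.mul_ne_top (by simp) hDtop), fun f g hf hg hfin hgin τ 𝒢 h𝒢 => ?_⟩
  have hl : Laminar (𝒢 : Set (Set (Fin n → ℝ))) := fun P hP Q hQ =>
    laminar_range_dcube τ P (h𝒢 hP) Q (h𝒢 hQ)
  have hcube : ∀ Q ∈ 𝒢, ∃ a l, 0 < l ∧ Q = cube a l := fun Q hQ => by
    obtain ⟨i, rfl⟩ := h𝒢 (Finset.mem_coe.2 hQ)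
    exact ⟨_, _, by positivity, rfl⟩
  have h𝒢' : ∀ Q ∈ 𝒢, MeasurableSet Q ∧ volume Q ≠ 0 ∧ volume Q ≠ ∞ := fun Q hQ => by
    obtain ⟨a, l, hl, rfl⟩ := hcube Q hQ
    exact ⟨measurableSet_cube a l, volume_cube_ne_zero a hl, volume_cube_ne_top a l⟩
  set F : (Fin n → ℝ) → ℝ≥0∞ := fun x => ‖f x‖ₑ ^ r * v₁ x ^ (r / p₁) with hF
  set G : (Fin n → ℝ) → ℝ≥0∞ := fun x => ‖g x‖ₑ ^ s * v₂ x ^ (s / p₂) with hG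
  have hFp : ∫⁻ x, F x ^ (p₁ / r) = ∫⁻ x, ‖f x‖ₑ ^ p₁ * v₁ x := by
    refine lintegral_congr fun x => ?_
    rw [hF, ENNReal.mul_rpow_of_nonneg _ _ (by positivity), ← ENNReal.rpow_mul,
      ← ENNReal.rpow_mul, mul_div_cancel₀ _ hr0.ne', div_mul_div_cancel₀ hp₁.ne',
      div_self hr0.ne', ENNReal.rpow_one]
  have hGp : ∫⁻ x, G x ^ (p₂ / s) = ∫⁻ x, ‖g x‖ₑ ^ p₂ * v₂ x := by
    refine lintegral_congr fun x => ?_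
    rw [hG, ENNReal.mul_rpow_of_nonneg _ _ (by positivity), ← ENNReal.rpow_mul,
      ← ENNReal.rpow_mul, mul_div_cancel₀ _ hs0.ne', div_mul_div_cancel₀ hp₂.ne',
      div_self hs0.ne', ENNReal.rpow_one]
  have hMF := hC₁ 𝒢 hl h𝒢' F ((hf.enorm.pow_const _).mul (hv₁.pow_const _))
  have hMG := hC₂ 𝒢 hl h𝒢' G ((hg.enorm.pow_const _).mul (hv₂.pow_const _))
  rw [hFp] at hMF
  rw [hGp] at hMG
  set MF := maxOn 𝒢 (fun Q => orliczAvg φ₁' Q F) with hMFdef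
  set MG := maxOn 𝒢 (fun Q => orliczAvg φ₂' Q G) with hMGdef
  have hMFm : Measurable MF := measurable_maxOn fun Q hQ => (h𝒢' Q hQ).1
  have hMGm : Measurable MG := measurable_maxOn fun Q hQ => (h𝒢' Q hQ).1
  -- Replacing the Orlicz averages by their maximal functions dominates every testing coefficient at
  -- once.
  set H : (Fin n → ℝ) → ℝ≥0∞ := fun x => (MF x ^ (1 / r) * MG x ^ (1 / s)) ^ p with hH
  set Nf := ∫⁻ x, ‖f x‖ₑ ^ p₁ * v₁ x
  set Ng := ∫⁻ x, ‖g x‖ₑ ^ p₂ * v₂ x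
  have hHint : ∫⁻ x, H x ≤ (C₁ * Nf) ^ (p / p₁) * (C₂ * Ng) ^ (p / p₂) := by
    calc ∫⁻ x, H x = ∫⁻ x, (MF x ^ (p₁ / r)) ^ (p / p₁) * (MG x ^ (p₂ / s)) ^ (p / p₂) := by
          refine lintegral_congr fun x => ?_
          simp only [hH]
          rw [ENNReal.mul_rpow_of_nonneg _ _ hp0.le, ← ENNReal.rpow_mul, ← ENNReal.rpow_mul,
            ← ENNReal.rpow_mul, ← ENNReal.rpow_mul]
          congr 2 <;> field_simp
      _ ≤ (∫⁻ x, MF x ^ (p₁ / r)) ^ (p / p₁) * (∫⁻ x, MG x ^ (p₂ / s)) ^ (p / p₂) :=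
          lintegral_rpow_mul_rpow_le (hMFm.pow_const _) (hMGm.pow_const _) (by positivity)
            (by positivity) hpp
      _ ≤ _ := by gcongr
  have hHfin : ∫⁻ x, H x ≠ ∞ := by
    refine ne_top_of_le_ne_top (ENNReal.mul_ne_top ?_ ?_) hHint
    · exact ENNReal.rpow_ne_top_of_nonneg (by positivity) (ENNReal.mul_ne_top ENNReal.coe_ne_top hfin)
    · exact ENNReal.rpow_ne_top_of_nonneg (by positivity) (ENNReal.mul_ne_top ENNReal.coe_ne_top hgin)
  have hmain := lintegral_maxOn_rpow_le (μ := volume) (ν := volume.withDensity u)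
    (A := fun Q => bilinAvg α r s f g Q ^ t)
    (h := fun Q => (orliczAvg φ₁' Q F ^ (1 / r) * orliczAvg φ₂' Q G ^ (1 / s)) ^ p) (H := H)
    hl (fun Q hQ => (h𝒢' Q hQ).1) (fun Q hQ => (h𝒢' Q hQ).2.2)
    (fun Q hQ 𝒮 h𝒮 hd hsub => sum_bilinAvg_rpow_mul_volume_le hα ht0 hr0 hs0 htrs
      (h𝒢' Q hQ).2.1 (h𝒢' Q hQ).2.2 (fun P hP => ⟨(h𝒢' P (h𝒮 hP)).1, (h𝒢' P (h𝒮 hP)).2.1⟩) hd hsub)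
    (e := q / t) (θ := q / p) (by positivity) ((one_le_div hp0).2 hpq) (K := K) hKtop
    (fun Q hQ => by
      obtain ⟨a, l, hl, rfl⟩ := hcube Q hQ
      rw [← ENNReal.rpow_mul, mul_div_cancel₀ _ ht0.ne']
      exact bilinAvg_rpow_mul_withDensity_le hr0 hs0 hp0 hq hp₁ hp₂ hψ hφ₁ hφ₂ hφφ₁' hφφ₂' hCψ
        hv₁ hv₂ hbump hf hg hfin hgin a hl)
    (fun Q hQ x hx => by
      simp only [hH]
      gcongr
      · exact le_maxOn (A := fun Q => orliczAvg φ₁' Q F) hQ hx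
      · exact le_maxOn (A := fun Q => orliczAvg φ₂' Q G) hQ hx)
    hHfin
  calc ∫⁻ x, maxOn 𝒢 (bilinAvg α r s f g) x ^ q ∂(volume.withDensity u)
      ≤ ∫⁻ x, maxOn 𝒢 (fun Q => bilinAvg α r s f g Q ^ t) x ^ (q / t) ∂(volume.withDensity u) := by
        refine lintegral_mono fun x => ?_
        have h1 : maxOn 𝒢 (bilinAvg α r s f g) x ≤
            maxOn 𝒢 (fun Q => bilinAvg α r s f g Q ^ t) x ^ t⁻¹ := by
          refine maxOn_le_iff.2 fun Q hQ hx => ?_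
          rw [ENNReal.le_rpow_inv_iff ht0]
          exact le_maxOn (A := fun Q => bilinAvg α r s f g Q ^ t) hQ hx
        refine (ENNReal.rpow_le_rpow h1 hq.le).trans (le_of_eq ?_)
        rw [← ENNReal.rpow_mul, inv_mul_eq_div]
    _ ≤ _ := hmain
    _ ≤ 2 ^ (q / t) * K * (4 * ((C₁ * Nf) ^ (p / p₁) * (C₂ * Ng) ^ (p / p₂)) ^ (q / p)) := by
        gcongr
    _ = _ := by
        rw [ENNReal.mul_rpow_of_nonneg _ _ (by positivity : 0 ≤ q / p), ← ENNReal.rpow_mul,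
          ← ENNReal.rpow_mul, show p / p₁ * (q / p) = q / p₁ by field_simp,
          show p / p₂ * (q / p) = q / p₂ by field_simp,
          ENNReal.mul_rpow_of_nonneg _ _ (by positivity : 0 ≤ q / p₁),
          ENNReal.mul_rpow_of_nonneg _ _ (by positivity : 0 ≤ q / p₂), hD]
        ring

lemma eLpNorm_withDensity_ofReal {E : Type*} [NormedAddCommGroup E] {h : (Fin n → ℝ) → E}
    {v : (Fin n → ℝ) → ℝ≥0∞} (hh : AEStronglyMeasurable h volume) (hv : AEMeasurable v volume)
    (hp : 0 < p) :
    eLpNorm h (ENNReal.ofReal p) (volume.withDensity v) =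
      (∫⁻ x, ‖h x‖ₑ ^ p * v x) ^ (1 / p) := by
  rw [eLpNorm_eq_lintegral_rpow_enorm_toReal (by simpa using hp) ENNReal.ofReal_ne_top,
    ENNReal.toReal_ofReal hp.le,
    lintegral_withDensity_eq_lintegral_mul₀ hv (hh.enorm.pow_const _)]
  simp only [Pi.mul_apply, mul_comm]

end Main

end BilinearBump

end

theorem mainTheorem6 (n : ℕ) (α p q p₁ p₂ r s : ℝ)
    (hα0 : 0 ≤ α) (hαn : α < n) (hr : 1 < r) (hrp : r < p₁) (hs : 1 < s) (hsp : s < p₂)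
    (hp : p = p₁ * p₂ / (p₁ + p₂)) (hp1 : 1 < p) (hpq : p ≤ q)
    (ψ φ₁ φ₂ ψ' φ₁' φ₂' : ℝ → ℝ)
    (hψ : BilinearBump.IsYoung ψ) (hφ₁ : BilinearBump.IsYoung φ₁)
    (hφ₂ : BilinearBump.IsYoung φ₂)
    (hψψ' : BilinearBump.IsAssociate ψ ψ') (hφφ₁' : BilinearBump.IsAssociate φ₁ φ₁')
    (hφφ₂' : BilinearBump.IsAssociate φ₂ φ₂')
    (hψB : BilinearBump.MemB (q / (q - 1)) ψ')
    (hφB₁ : BilinearBump.MemB (p₁ / r) φ₁')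
    (hφB₂ : BilinearBump.MemB (p₂ / s) φ₂')
    (u v₁ v₂ : (Fin n → ℝ) → ENNReal)
    (hu : AEMeasurable u volume) (hv₁ : AEMeasurable v₁ volume) (hv₂ : AEMeasurable v₂ volume)
    (hbump : BilinearBump.bumpConst α p q p₁ p₂ r s ψ φ₁ φ₂ u v₁ v₂ < ⊤) :
    ∃ C : NNReal, ∀ f g : (Fin n → ℝ) → ℂ,
      AEStronglyMeasurable f volume → AEStronglyMeasurable g volume →
      MemLp f (ENNReal.ofReal p₁) (volume.withDensity v₁) →
      MemLp g (ENNReal.ofReal p₂) (volume.withDensity v₂) →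
      eLpNorm (BilinearBump.maximalFn α r s f g) (ENNReal.ofReal q) (volume.withDensity u)
        ≤ C * eLpNorm f (ENNReal.ofReal p₁) (volume.withDensity v₁)
            * eLpNorm g (ENNReal.ofReal p₂) (volume.withDensity v₂) := by
  have hr0 : 0 < r := by linarith
  have hs0 : 0 < s := by linarith
  have hp₁ : 0 < p₁ := by linarith
  have hp₂ : 0 < p₂ := by linarith
  have hq : 0 < q := by linarith
  obtain ⟨C, hC, hbound⟩ := BilinearBump.exists_lintegral_maxOn_bilinAvg_le hα0 hr hs hrp hsp hp hpq
    hp1 hψ hφ₁ hφ₂ hψψ' hφφ₁' hφφ₂' hψB hφB₁ hφB₂ hv₁ hv₂ hbump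
  set κ : ENNReal := 2 ^ n * (((6 : ENNReal) ^ n) ^ (1 / r) * (6 ^ n) ^ (1 / s)) ^ q with hκ
  have hκtop : κ ≠ ⊤ := by
    refine ENNReal.mul_ne_top (by finiteness) (ENNReal.rpow_ne_top_of_nonneg hq.le
      (ENNReal.mul_ne_top ?_ ?_)) <;>
    exact ENNReal.rpow_ne_top_of_nonneg (by positivity) (by finiteness)
  have hκC : (κ * C) ^ (1 / q) ≠ ⊤ :=
    ENNReal.rpow_ne_top_of_nonneg (by positivity) (ENNReal.mul_ne_top hκtop hC)
  refine ⟨((κ * C) ^ (1 / q)).toNNReal, fun f g hf hg hfm hgm => ?_⟩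
  have hfe := BilinearBump.eLpNorm_withDensity_ofReal hf hv₁ hp₁
  have hge := BilinearBump.eLpNorm_withDensity_ofReal hg hv₂ hp₂
  have hfin : ∫⁻ x, ‖f x‖ₑ ^ p₁ * v₁ x ≠ ⊤ := by
    intro htop
    rw [htop, ENNReal.top_rpow_of_pos (by positivity)] at hfe
    exact hfm.eLpNorm_lt_top.ne hfe
  have hgin : ∫⁻ x, ‖g x‖ₑ ^ p₂ * v₂ x ≠ ⊤ := by
    intro htop
    rw [htop, ENNReal.top_rpow_of_pos (by positivity)] at hge
    exact hgm.eLpNorm_lt_top.ne hge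
  have h1 := BilinearBump.lintegral_maximalFn_rpow_le hα0 hr0 hs0 (volume.withDensity u) hq
    fun τ => BilinearBump.lintegral_dyadicMax_rpow_le τ _ _ hq
      (hbound f g hf hg hfin hgin τ)
  rw [eLpNorm_eq_lintegral_rpow_enorm_toReal (by simpa using hq) ENNReal.ofReal_ne_top,
    ENNReal.toReal_ofReal hq.le, hfe, hge, ENNReal.coe_toNNReal hκC]
  simp only [enorm_eq_self]
  refine (ENNReal.rpow_le_rpow h1 (by positivity)).trans (le_of_eq ?_)
  rw [← hκ, ← mul_assoc κ, ENNReal.mul_rpow_of_nonneg _ _ (by positivity),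
    ENNReal.mul_rpow_of_nonneg (_ ^ (q / p₁)) _ (by positivity), ← ENNReal.rpow_mul,
    ← ENNReal.rpow_mul, show q / p₁ * (1 / q) = 1 / p₁ by field_simp,
    show q / p₂ * (1 / q) = 1 / p₂ by field_simp,
    mul_assoc ((κ * C) ^ (1 / q))]
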